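/- Let $(X,\mu,R,\sigma)$ be a Feldman–Moore relation: $(X,\mu)$ is a standard Borel probability space, $R\subseteq X\times X$ is a Borel equivalence relation with countable classes under which $\mu$ is quasi-invariant (for Borel $\alpha\subseteq X$, $\mu(\alpha)=0$ if and only if its $R$-saturation is $\mu$-null), and $\sigma$ is a normalised Borel $2$-cocycle with values in $\mathbb T$, that is, $\sigma(x,y,z)\sigma(x,z,w)=\sigma(x,y,w)\sigma(y,z,w)$ whenever $x\sim y\sim z\sim w$, and $\sigma(x,y,z)=1$ whenever two of $x\sim y\sim z$ are equal. Let $\nu(E)=\int_X|\{x:(x,y)\in E\}|\,d\mu(y)$ be the right counting measure on $R$ and $H=L^2(R,\nu)$. For a bounded Borel function $a$ on $R$ whose support has uniformly bounded horizontal and vertical slices (a left finite function), let $L_0(a)\in\mathcal B(H)$ be the operator $(L_0(a)\xi)(x,z)=\sum_{y\sim x}a(x,y)\xi(y,z)\sigma(x,y,z)$. Let $\mathcal M=\mathcal M(R,\sigma)$ be the von Neumann algebra generated by all such $L_0(a)$; let $s\colon\mathcal M\to H$, $s(T)=T\chi_\Delta$, with $\Delta$ the diagonal of $R$, let $\Sigma=s(\mathcal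 M)$, and let $L=s^{-1}\colon\Sigma\to\mathcal M$. For $\alpha\in L^\infty(X,\mu)$ let $D(\alpha)=L_0(d(\alpha))$, where $d(\alpha)(x,y)=\alpha(x)$ if $x=y$ and $0$ otherwise, and let $\mathcal A=\mathcal A(R)=\{D(\alpha):\alpha\in L^\infty(X,\mu)\}$. A function $\varphi\in L^\infty(R,\nu)$ is a Schur multiplier if the pointwise product $\varphi a$ is in $\Sigma$ for every $a\in\Sigma$; then $M(\varphi)\colon\mathcal M\to\mathcal M$ is the map $T\mapsto L(\varphi\, s(T))$. Let $\mathfrak S(R,\sigma)$ be the set of Schur multipliers. An element $u$ of the extended Haagerup tensor product $\mathcal A\otimes_{eh}\mathcal A$ is given by a series $\sum_{i=1}^\infty A_i\otimes B_i$ with $A_i,B_i\in\mathcal A$ such that $\sum_iA_iA_i^*$ and $\sum_iB_i^*B_i$ converge weak* to bounded operators; two series give the same element if $\sum_if(A_i)g(B_i)$ agree for all normal functionals $f,g$. The norm $\|u\|_{eh}$ is the infimum of the constants $C$ such that some representing series satisfies $\|\sum_iA_iA_i^*\|\le C$ and $\|\sum_iB_i^*B_i\|\le C$. Then, for every $u\in\mathcal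 A\otimes_{eh}\mathcal A$: 1. There is a completely bounded linear map $\Psi_u\colon\mathcal B(H)\to\mathcal B(H)$ such that $\Psi_u(T)=\sum_{i=1}^\infty A_iTB_i$, the series converging weak*, for every $T\in\mathcal B(H)$ and every series $\sum_iA_i\otimes B_i$ that represents $u$. 2. There is an element $\varphi_u\in L^\infty(R,\nu)$ such that $\varphi_u(x,y)=\sum_{i=1}^\infty a_i(x)b_i(y)$ for $\nu$-almost every $(x,y)\in R$, for every series $\sum_i D(a_i)\otimes D(b_i)$ that represents $u$. 3. $\varphi_u\in\mathfrak S(R,\sigma)$, the map $M(\varphi_u)$ is a bounded linear map on $\mathcal M$, it is the restriction of $\Psi_u$ to $\mathcal M$, and $\|M(\varphi_u)\|\le\|u\|_{eh}$. Hence $\mathfrak A(R)=\{\varphi_u:u\in\mathcal A\otimes_{eh}\mathcal A\}\subseteq\mathfrak S(R,\sigma)$. -/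

import Mathlib

open MeasureTheory Filter Topology
open scoped ENNReal

/-! ### Operators on a Hilbert space: weak* limits, matrix norms, generated von Neumann algebras -/

section HilbertSpace

variable {H : Type*} [NormedAddCommGroup H] [InnerProductSpace ℂ H] [CompleteSpace H]

/-- The normal (weak*-continuous) functional on `B(H)` given by two square-summable sequences
`ξ`, `η` of vectors: `T ↦ ∑ₙ ⟨T ξₙ, ηₙ⟩`. Every normal functional is of this form, so these
functionals are the predual of `B(H)`, and their restrictions to a von Neumann algebra `𝒜 ⊆ B(H)`
are the predual of `𝒜`. -/
noncomputable def normalFunctional (ξ η : lp (fun _ : ℕ => H) 2) (T : H →L[ℂ] H) : ℂ :=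
  ∑' n, inner ℂ (η n) (T (ξ n))

/-- Convergence of a sequence of operators in the weak* (ultraweak) topology of `B(H)`. -/
def TendstoWeakStar (S : ℕ → (H →L[ℂ] H)) (T : H →L[ℂ] H) : Prop :=
  ∀ ξ η : lp (fun _ : ℕ => H) 2,
    Tendsto (fun n => normalFunctional ξ η (S n)) atTop (𝓝 (normalFunctional ξ η T))

/-- `T = ∑ᵢ Sᵢ`, the partial sums converging in the weak* topology of `B(H)`. -/
def HasWeakStarSum (S : ℕ → (H →L[ℂ] H)) (T : H →L[ℂ] H) : Prop :=
  TendstoWeakStar (fun n => ∑ i ∈ Finset.range n, S i) T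

/-- The operator on the Hilbert space `Hⁿ` given by an `n × n` matrix of operators on `H`. -/
noncomputable def matrixOperator {n : ℕ} (T : Matrix (Fin n) (Fin n) (H →L[ℂ] H)) :
    PiLp 2 (fun _ : Fin n => H) →L[ℂ] PiLp 2 (fun _ : Fin n => H) :=
  ((PiLp.continuousLinearEquiv 2 ℂ (fun _ : Fin n => H)).symm :
      (Fin n → H) →L[ℂ] PiLp 2 (fun _ : Fin n => H)) ∘L
    (ContinuousLinearMap.pi fun j => ∑ k, T j k ∘L ContinuousLinearMap.proj k) ∘L
    ((PiLp.continuousLinearEquiv 2 ℂ (fun _ : Fin n => H)) :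
      PiLp 2 (fun _ : Fin n => H) →L[ℂ] (Fin n → H))

/-- A linear map `Ψ` on `B(H)` is completely bounded if its entrywise amplifications to
`Mₙ(B(H)) = B(Hⁿ)` are bounded uniformly in `n`. -/
def IsCompletelyBounded (Ψ : (H →L[ℂ] H) →ₗ[ℂ] (H →L[ℂ] H)) : Prop :=
  ∃ C : ℝ, ∀ (n : ℕ) (T : Matrix (Fin n) (Fin n) (H →L[ℂ] H)),
    ‖matrixOperator (T.map Ψ)‖ ≤ C * ‖matrixOperator T‖

/-- The von Neumann algebra generated by a set `S` of operators: the bicommutant of `S ∪ S*`. -/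
noncomputable def generatedVonNeumannAlgebra (S : Set (H →L[ℂ] H)) : VonNeumannAlgebra H where
  toStarSubalgebra :=
    StarSubalgebra.centralizer ℂ (StarSubalgebra.centralizer ℂ S : Set (H →L[ℂ] H))
  centralizer_centralizer' := by
    change Set.centralizer (Set.centralizer (Set.centralizer _)) = Set.centralizer _
    exact Set.centralizer_centralizer_centralizer _

/-! ### The extended Haagerup tensor product -/

/-- A formal series `∑ᵢ Aᵢ ⊗ Bᵢ` with `Aᵢ, Bᵢ ∈ 𝒜`, such that `∑ᵢ Aᵢ Aᵢ*` and `∑ᵢ Bᵢ* Bᵢ`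
converge in the weak* topology, to the bounded operators `row` and `col`. -/
structure EhSeries (𝒜 : Set (H →L[ℂ] H)) where
  A : ℕ → (H →L[ℂ] H)
  B : ℕ → (H →L[ℂ] H)
  row : H →L[ℂ] H
  col : H →L[ℂ] H
  A_mem : ∀ i, A i ∈ 𝒜
  B_mem : ∀ i, B i ∈ 𝒜
  hasSum_row : HasWeakStarSum (fun i => A i * star (A i)) row
  hasSum_col : HasWeakStarSum (fun i => star (B i) * B i) col

/-- Two series represent the same element of `𝒜 ⊗_eh 𝒜` if they define the same bilinear form
`(f, g) ↦ ∑ᵢ f(Aᵢ) g(Bᵢ)` on (normal functionals) × (normal functionals). -/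
def EhSeries.setoid (𝒜 : Set (H →L[ℂ] H)) : Setoid (EhSeries 𝒜) where
  r v w := ∀ ξ η ξ' η' : lp (fun _ : ℕ => H) 2,
    ∑' i, normalFunctional ξ η (v.A i) * normalFunctional ξ' η' (v.B i) =
      ∑' i, normalFunctional ξ η (w.A i) * normalFunctional ξ' η' (w.B i)
  iseqv :=
    ⟨fun _ _ _ _ _ => rfl, fun h ξ η ξ' η' => (h ξ η ξ' η').symm,
      fun h k ξ η ξ' η' => (h ξ η ξ' η').trans (k ξ η ξ' η')⟩

/-- The extended Haagerup tensor product `𝒜 ⊗_eh 𝒜` of a von Neumann algebra `𝒜` on a separable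
Hilbert space with itself (countable series suffice by separability). -/
def EhTensor (𝒜 : Set (H →L[ℂ] H)) : Type _ := Quotient (EhSeries.setoid 𝒜)

namespace EhTensor

variable {𝒜 : Set (H →L[ℂ] H)}

/-- The series `w` represents the element `u` of `𝒜 ⊗_eh 𝒜`. -/
def Represents (w : EhSeries 𝒜) (u : EhTensor 𝒜) : Prop :=
  Quotient.mk (EhSeries.setoid 𝒜) w = u

/-- The norm `‖u‖_eh`: the least constant `C` such that `u = ∑ᵢ Aᵢ ⊗ Bᵢ` for some series with
`‖∑ᵢ Aᵢ Aᵢ*‖ ≤ C` and `‖∑ᵢ Bᵢ* Bᵢ‖ ≤ C`. -/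
noncomputable def ehNorm (u : EhTensor 𝒜) : ℝ :=
  sInf {C : ℝ | ∃ w : EhSeries 𝒜, Represents w u ∧ ‖w.row‖ ≤ C ∧ ‖w.col‖ ≤ C}

/-- `Ψ = Ψ_u`: for every representing series `u = ∑ᵢ Aᵢ ⊗ Bᵢ` and every `T ∈ B(H)`, the series
`∑ᵢ Aᵢ T Bᵢ` converges to `Ψ(T)` in the weak* topology. -/
def IsInducedMap (u : EhTensor 𝒜) (Ψ : (H →L[ℂ] H) →ₗ[ℂ] (H →L[ℂ] H)) : Prop :=
  ∀ w : EhSeries 𝒜, Represents w u →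
    ∀ T : H →L[ℂ] H, HasWeakStarSum (fun i => w.A i * T * w.B i) (Ψ T)

end EhTensor

end HilbertSpace

/-! ### Feldman-Moore relations -/

/-- A Feldman-Moore relation `(X, μ, R, σ)` on a standard Borel space `X`: a Borel probability
measure `μ`, a countable Borel equivalence relation `R = rel` under which `μ` is quasi-invariant,
and a normalised Borel 2-cocycle `σ` with values in the unit circle. The cocycle matters only on
`R⁽²⁾ = {(x, y, z) : x ∼ y ∼ z}`, and a Borel function on `R⁽²⁾` is extended arbitrarily to a Borel
function on `X × X × X`. -/
structure FeldmanMoore (X : Type*) [MeasurableSpace X] [StandardBorelSpace X] where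
  μ : Measure X
  isProbabilityMeasure : IsProbabilityMeasure μ
  rel : Set (X × X)
  measurableSet_rel : MeasurableSet rel
  equivalence : Equivalence fun x y => (x, y) ∈ rel
  countable_class : ∀ x, {y | (x, y) ∈ rel}.Countable
  quasiInvariant : ∀ α : Set X, MeasurableSet α →
    (μ α = 0 ↔ μ {y | ∃ x ∈ α, (x, y) ∈ rel} = 0)
  σ : X → X → X → Circle
  measurable_σ : Measurable fun p : X × X × X => (σ p.1 p.2.1 p.2.2 : ℂ)
  cocycle : ∀ x y z w, (x, y) ∈ rel → (y, z) ∈ rel → (z, w) ∈ rel →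
    σ x y z * σ x z w = σ x y w * σ y z w
  normalised : ∀ x y z, (x, y) ∈ rel → (y, z) ∈ rel → (x = y ∨ y = z ∨ x = z) → σ x y z = 1

namespace FeldmanMoore

variable {X : Type*} [MeasurableSpace X] [StandardBorelSpace X] (F : FeldmanMoore X)

/-- The right counting measure `ν(E) = ∫ |{x : (x, y) ∈ E}| dμ(y)` for `E ⊆ R`, regarded as a
measure on `X × X` that is carried by the Borel set `R`: the integral over `y` of the counting
measures on the slices `{x : x ∼ y} × {y}`. -/
noncomputable def ν : Measure (X × X) :=
  F.μ.bind fun y =>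
    ((Measure.count : Measure X).restrict {x | (x, y) ∈ F.rel}).map fun x => (x, y)

/-- `H = L²(R, ν)`. As `ν` is carried by `R`, this is `L²(X × X, ν)`. -/
abbrev Hil : Type _ := Lp ℂ 2 F.ν

/-- The set `Σ₀` of left finite functions: bounded Borel functions on `R` with band limited
support. A function on `R` is regarded as a function on `X × X` that vanishes off `R`. -/
def leftFinite : Set (X × X → ℂ) :=
  {a | Measurable a ∧ (∃ C : ℝ, ∀ p, ‖a p‖ ≤ C) ∧ Function.support a ⊆ F.rel ∧
    ∃ N : ℕ, ∀ x y : X, {z | a (z, y) ≠ 0}.encard + {z | a (x, z) ≠ 0}.encard ≤ N}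

/-- `T = L₀(a)`: for every `ξ ∈ H`, `(T ξ)(x, z) = ∑_{y ∼ x} a(x, y) ξ(y, z) σ(x, y, z)` for
`ν`-almost every `(x, z)`. The sum is over `y ∼ x` because `a` vanishes off `R`; it has finitely
many nonzero terms. -/
def IsLeftConvolution (a : X × X → ℂ) (T : F.Hil →L[ℂ] F.Hil) : Prop :=
  ∀ ξ : F.Hil, ∀ᵐ p ∂F.ν, T ξ p = ∑' y, a (p.1, y) * ξ (y, p.2) * (F.σ p.1 y p.2 : ℂ)

/-- `M₀(R, σ) = L₀(Σ₀)`. -/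
def M₀ : Set (F.Hil →L[ℂ] F.Hil) :=
  {T | ∃ a ∈ F.leftFinite, F.IsLeftConvolution a T}

/-- The von Neumann algebra `M(R, σ)` of the relation. -/
noncomputable def M : VonNeumannAlgebra F.Hil := generatedVonNeumannAlgebra F.M₀

lemma measurableSet_diagonal : MeasurableSet (Set.diagonal X) := by
  let _ := upgradeStandardBorel X
  exact isClosed_diagonal.measurableSet

lemma ν_diagonal_ne_top : F.ν (Set.diagonal X) ≠ ∞ := by
  have := F.isProbabilityMeasure
  refine ne_top_of_le_ne_top ENNReal.one_ne_top
    ((Measure.bind_apply_le _ measurableSet_diagonal).trans ?_)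
  calc _ ≤ ∫⁻ _, 1 ∂F.μ := by
        refine lintegral_mono fun y => ?_
        have hm : Measurable fun x : X => (x, y) := measurable_id.prodMk measurable_const
        rw [Measure.map_apply hm measurableSet_diagonal]
        refine (Measure.restrict_apply_le _ _).trans ?_
        have : (fun x : X => (x, y)) ⁻¹' Set.diagonal X = {y} := by
          ext x; simp
        rw [this, Measure.count_singleton]
    _ = 1 := by simp

/-- The unit vector `χ_Δ ∈ H`. -/
noncomputable def χΔ : F.Hil :=
  indicatorConstLp 2 measurableSet_diagonal F.ν_diagonal_ne_top (1 : ℂ)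

/-- The symbol map `s(T) = T χ_Δ`. -/
noncomputable def symbol (T : F.Hil →L[ℂ] F.Hil) : F.Hil := T F.χΔ

/-- The symbol set `Σ(R, σ) = s(M)`. -/
def symbolSet : Set F.Hil := F.symbol '' (F.M : Set (F.Hil →L[ℂ] F.Hil))

/-- The inverse symbol map `L : Σ(R, σ) → M`, the inverse of the restriction of `s` to `M`. -/
noncomputable def invSymbol : F.Hil → (F.Hil →L[ℂ] F.Hil) :=
  Function.invFunOn F.symbol (F.M : Set (F.Hil →L[ℂ] F.Hil))

/-- The set `𝔖(R, σ)` of Schur multipliers: those `φ ∈ L^∞(R, ν)` whose pointwise product with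
every symbol is again a symbol. Here `φ • a` is the pointwise product of `φ ∈ L^∞` and `a ∈ L²`. -/
def schurMultipliers : Set (Lp ℂ ∞ F.ν) :=
  {φ | ∀ a ∈ F.symbolSet, (φ • a : Lp ℂ 2 F.ν) ∈ F.symbolSet}

/-- The map `M(φ) : T ↦ L(φ ⋆ s(T))` of a Schur multiplier `φ`. -/
noncomputable def schurMap (φ : Lp ℂ ∞ F.ν) (T : F.Hil →L[ℂ] F.Hil) : F.Hil →L[ℂ] F.Hil :=
  F.invSymbol (φ • F.symbol T : Lp ℂ 2 F.ν)

open Classical in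
/-- `d(α)(x, y)` is `α(x)` if `x = y` and `0` otherwise. -/
noncomputable def diagFun (α : X → ℂ) : X × X → ℂ := fun p => if p.1 = p.2 then α p.1 else 0

/-- `T = D(α) = L(d(α))`, for the class in `L^∞(X, μ)` of a bounded Borel function `α`. -/
def IsDiagonal (α : X → ℂ) (T : F.Hil →L[ℂ] F.Hil) : Prop :=
  Measurable α ∧ (∃ C : ℝ, ∀ x, ‖α x‖ ≤ C) ∧ F.IsLeftConvolution (diagFun α) T

/-- The Cartan masa `A(R) = {D(α) : α ∈ L^∞(X, μ)}`. -/
def cartanMasa : Set (F.Hil →L[ℂ] F.Hil) := {T | ∃ α, F.IsDiagonal α T}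

/-- `φ = φ_u`, the class in `L^∞(R, ν)` of the restriction to `R` of the function
`f_u(x, y) = ∑ᵢ aᵢ(x) bᵢ(y)`, for all representations `u = ∑ᵢ D(aᵢ) ⊗ D(bᵢ)`. -/
def IsEhSymbol (u : EhTensor F.cartanMasa) (φ : Lp ℂ ∞ F.ν) : Prop :=
  ∀ w : EhSeries F.cartanMasa, EhTensor.Represents w u →
    ∀ a b : ℕ → X → ℂ, (∀ i, F.IsDiagonal (a i) (w.A i)) → (∀ i, F.IsDiagonal (b i) (w.B i)) →
      ∀ᵐ p ∂F.ν, φ p = ∑' i, a i p.1 * b i p.2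

/-- `𝔄(R) = {φ_u : u ∈ A ⊗_eh A}`. -/
def ehMultipliers : Set (Lp ℂ ∞ F.ν) := {φ | ∃ u, F.IsEhSymbol u φ}

end FeldmanMoore

/-! A series representing `u` is a row of operators `Aᵢ` against a column `Bᵢ`, and `T ↦ ∑ᵢ Aᵢ T Bᵢ`
is the composite row · (T ⊗ 1) · column through ℓ²(H) (`elementaryMap`). This factorisation gives
complete boundedness, weak* convergence and the norm estimate. Inserting an orthonormal basis
between `T` and `Bᵢ` expresses its matrix coefficients through the bilinear form of `u` alone, so
the map does not depend on the series (`EhSeries.map_eq_of_represents`).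

The link with Schur multiplication is that `Aᵢ` multiplies by `aᵢ(x)`, while on χ_Δ the operator
`Bᵢ` agrees with multiplication by `bᵢ(y)` in the right coordinate, which commutes with `M`. Thus
`Aᵢ T Bᵢ` has symbol `aᵢ(x) bᵢ(y) s(T)(x, y)`, and summing gives `s(Ψ T) = φ s(T)`
(`symbol_map_eq`). As Ψ preserves `M` (`map_mem_M`), φ is a Schur multiplier.

Identifying `M(φ)` with the restriction of Ψ needs `s` to be injective on `M`, that is, χ_Δ must be
separating (`eq_zero_of_apply_χΔ`). The commutant of `M` contains cocycle-twisted shifts of the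
right coordinate along partial isomorphisms of `R` with bounded density, and these carry χ_Δ to
indicators of pieces of graphs. Countably many such pieces cover `R` because `R` is, up to a null
set, a countable union of Borel graphs. This is an almost-everywhere Lusin–Novikov theorem, proved
here from the measurability of analytic sets. The same cover makes the slice measures defining ν an
a.e. measurable family.

That φ is well defined is more delicate. Equality in the tensor product gives equal integrals over
rectangles, hence equality μ × μ-a.e., but ν may be singular to μ × μ. Continuity of the ℓ² pairing
improves this to equality on a product of two conull sets (`exists_forall_tsum_mul_eq`), and
quasi-invariance makes such a product conull for ν. -/

section DescriptiveSetTheory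

/-! ### Analytic sets and compact approximation from inside. -/

/-- The points of Baire space whose first `k` coordinates are bounded by those of `u`. -/
def baireBox (u : ℕ → ℕ) (k : ℕ) : Set (ℕ → ℕ) := {s | ∀ i < k, s i ≤ u i}

/-- The coordinates are bounded one at a time: the boxes with one more bounded coordinate increase
to the previous box, and continuity from below for increasing sequences holds for non-measurable
images too. -/
lemma exists_lt_measure_image_baireBox {Y : Type*} [MeasurableSpace Y] (μ : Measure Y)
    (g : (ℕ → ℕ) → Y) {c : ℝ≥0∞} (hc : c < μ (Set.range g)) :
    ∃ u : ℕ → ℕ, ∀ k, c < μ (g '' baireBox u k) := by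
  have step : ∀ (u : ℕ → ℕ) (k : ℕ), c < μ (g '' baireBox u k) →
      ∃ m, c < μ (g '' baireBox (Function.update u k m) (k + 1)) := by
    intro u k h
    have hU : baireBox u k = ⋃ m, baireBox (Function.update u k m) (k + 1) := by
      ext s
      simp only [baireBox, Set.mem_ofPred_eq, Set.mem_iUnion]
      constructor
      · intro hs
        refine ⟨s k, fun i hi => ?_⟩
        rcases Nat.lt_succ_iff_lt_or_eq.1 hi with h | rfl
        · rw [Function.update_of_ne h.ne]; exact hs i h
        · simp
      · rintro ⟨m, hs⟩ i hi
        simpa [Function.update_of_ne hi.ne] using hs i (hi.trans (Nat.lt_succ_self k))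
    have hmono : Monotone fun m => g '' baireBox (Function.update u k m) (k + 1) := by
      intro m m' hm
      refine Set.image_mono fun s hs i hi => ?_
      have := hs i hi
      by_cases h : i = k
      · subst h; simp at this ⊢; omega
      · rwa [Function.update_of_ne h] at this ⊢
    rw [hU, Set.image_iUnion, hmono.directed_le.measure_iUnion] at h
    exact lt_iSup_iff.1 h
  choose! m hm using step
  let U : (k : ℕ) → {u : ℕ → ℕ // c < μ (g '' baireBox u k)} := fun k => by
    induction k with
    | zero => exact ⟨0, by simpa [baireBox] using hc⟩
    | succ k ih => exact ⟨Function.update ih.1 k (m ih.1 k), hm _ _ ih.2⟩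
  have hU : ∀ k, (U (k + 1)).1 = Function.update (U k).1 k (m (U k).1 k) := fun k => rfl
  have hstab : ∀ i k, i < k → (U k).1 i = (U (i + 1)).1 i := by
    intro i k hik
    induction k, hik using Nat.le_induction with
    | base => rfl
    | succ k hk ih => rw [hU, Function.update_of_ne (by omega), ih]
  refine ⟨fun i => (U (i + 1)).1 i, fun k => ?_⟩
  have : baireBox (fun i => (U (i + 1)).1 i) k = baireBox (U k).1 k := by
    ext s
    refine forall₂_congr fun i hi => ?_
    rw [hstab i k hi]
  rw [this]
  exact (U k).2

lemma isCompact_setOf_le (u : ℕ → ℕ) : IsCompact {s : ℕ → ℕ | ∀ i, s i ≤ u i} := by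
  have : {s : ℕ → ℕ | ∀ i, s i ≤ u i} = Set.univ.pi fun i => Set.Iic (u i) := by
    ext s; simp [Pi.le_def]
  rw [this]
  exact isCompact_univ_pi fun i => (Set.finite_Iic _).isCompact

lemma exists_baireBox_subset {u : ℕ → ℕ} {V : Set (ℕ → ℕ)} (hV : IsOpen V)
    (h : {s : ℕ → ℕ | ∀ i, s i ≤ u i} ⊆ V) : ∃ k, baireBox u k ⊆ V := by
  let := PiNat.metricSpaceNatNat
  obtain ⟨δ, hδ, hsub⟩ := (isCompact_setOf_le u).exists_thickening_subset_open hV h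
  obtain ⟨k, hk⟩ := exists_pow_lt_of_lt_one hδ (by norm_num : (1 / 2 : ℝ) < 1)
  refine ⟨k, fun s hs => hsub ?_⟩
  rw [Metric.mem_thickening_iff]
  -- Truncating `s` by `u` lands in the compact set and leaves the first `k` coordinates unchanged.
  refine ⟨fun i => min (s i) (u i), fun i => min_le_right _ _, lt_of_le_of_lt ?_ hk⟩
  refine PiNat.mem_cylinder_iff_dist_le.1 ?_
  rw [PiNat.mem_cylinder_iff]
  intro i hi
  exact (min_eq_left (hs i hi)).symm

/-- Analytic sets are measurable up to null sets. -/
theorem MeasureTheory.AnalyticSet.nullMeasurableSet {Y : Type*} [TopologicalSpace Y] [PolishSpace Y]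
    [MeasurableSpace Y] [BorelSpace Y] (μ : Measure Y) [IsFiniteMeasure μ] {A : Set Y}
    (hA : AnalyticSet A) : NullMeasurableSet A μ := by
  rw [AnalyticSet] at hA
  rcases hA with rfl | ⟨g, hg, rfl⟩
  · exact nullMeasurableSet_empty
  have approx : ∀ c < μ (Set.range g), ∃ B ⊆ Set.range g, MeasurableSet B ∧ c ≤ μ B := by
    intro c hc
    obtain ⟨u, hu⟩ := exists_lt_measure_image_baireBox μ g hc
    have hK := (isCompact_setOf_le u).image hg
    refine ⟨_, Set.image_subset_range g _, hK.measurableSet, ?_⟩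
    -- Outer regularity: every open set around the compact image already contains the image of some
    -- box, which has measure above `c`.
    rw [Set.measure_eq_iInf_isOpen]
    refine le_iInf₂ fun U hU => le_iInf fun hUo => ?_
    obtain ⟨k, hk⟩ := exists_baireBox_subset (hUo.preimage hg) (Set.image_subset_iff.1 hU)
    exact (hu k).le.trans (measure_mono (Set.image_subset_iff.2 hk))
  rcases eq_or_ne (μ (Set.range g)) 0 with h0 | h0
  · exact NullMeasurableSet.of_null h0
  obtain ⟨c, -, hc, hlim⟩ := exists_seq_strictMono_tendsto' (pos_iff_ne_zero.2 h0)
  choose B hBs hBm hB using fun n => approx (c n) (hc n).2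
  have hsub : (⋃ n, B n) ⊆ Set.range g := Set.iUnion_subset hBs
  have hle : μ (Set.range g) ≤ μ (⋃ n, B n) :=
    le_of_tendsto' hlim fun n => (hB n).trans (measure_mono (Set.subset_iUnion B n))
  have h1 : (⋃ n, B n) =ᵐ[μ] toMeasurable μ (Set.range g) := by
    refine ae_eq_of_subset_of_measure_ge (hsub.trans (subset_toMeasurable _ _)) ?_
      (MeasurableSet.iUnion hBm).nullMeasurableSet (measure_ne_top _ _)
    rwa [measure_toMeasurable]
  have h2 : (⋃ n, B n) =ᵐ[μ] Set.range g :=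
    (LE.le.eventuallyLE hsub).antisymm
      ((LE.le.eventuallyLE (subset_toMeasurable μ (Set.range g))).trans h1.symm.le)
  exact NullMeasurableSet.congr (MeasurableSet.iUnion hBm).nullMeasurableSet h2

end DescriptiveSetTheory

/-! ### Almost-everywhere Lusin–Novikov uniformisation for continuous maps. -/

section LusinNovikov

/-- Without isolated points the set would be perfect and nonempty, so it would contain a copy of
Cantor space, which is uncountable. -/
lemma IsClosed.exists_isolated_of_countable {P : Type*} [TopologicalSpace P] [PolishSpace P]
    {C : Set P} (hC : IsClosed C) (hcount : C.Countable) (hne : C.Nonempty) :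
    ∃ p ∈ C, ∃ U, IsOpen U ∧ U ∩ C = {p} := by
  by_contra! hcon
  have hpre : Preperfect C := by
    rw [preperfect_iff_nhds]
    intro x hx U hU
    obtain ⟨V, hVU, hV, hxV⟩ := mem_nhds_iff.1 hU
    by_contra! h
    refine hcon x hx V hV (Set.Subset.antisymm (fun y hy => h y ⟨hVU hy.1, hy.2⟩) ?_)
    rintro y rfl
    exact ⟨hxV, hx⟩
  let := TopologicalSpace.upgradeIsCompletelyMetrizable P
  obtain ⟨f, hf, -, hinj⟩ := Perfect.exists_nat_bool_injection (hC := ⟨hC, hpre⟩) hne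
  have h1 : (Set.range f).Countable := hcount.mono hf
  have h2 : (Set.univ : Set (ℕ → Bool)).Countable :=
    Set.countable_of_injective_of_countable_image (f := f) hinj.injOn (by simpa using h1)
  have := Set.countable_univ_iff.1 h2
  obtain ⟨e, he⟩ := exists_surjective_nat (ℕ → Bool)
  obtain ⟨n, hn⟩ := he fun n => !(e n n)
  simpa using congrFun hn n

/-- Countable unions of Borel sets on which `h` is injective, with almost all fibres of the
complement closed. -/
def IsUniformized {P Y : Type*} [TopologicalSpace P] [MeasurableSpace P] [MeasurableSpace Y]
    (μ : Measure Y) (h : P → Y) (G : Set P) : Prop :=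
  (∃ S : ℕ → Set P, (∀ n, MeasurableSet (S n)) ∧ (∀ n, Set.InjOn h (S n)) ∧ G = ⋃ n, S n) ∧
    ∀ᵐ y ∂μ, IsClosed (h ⁻¹' {y} \ G)

lemma IsUniformized.measurableSet {P Y : Type*} [TopologicalSpace P] [MeasurableSpace P] [MeasurableSpace Y]
    {μ : Measure Y} {h : P → Y} {G : Set P}
    (hG : IsUniformized μ h G) : MeasurableSet G := by
  obtain ⟨⟨S, hS, -, rfl⟩, -⟩ := hG
  exact MeasurableSet.iUnion hS

lemma IsUniformized.iUnion {P Y : Type*} [TopologicalSpace P] [MeasurableSpace P] [MeasurableSpace Y]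
    {μ : Measure Y} {h : P → Y} {ι : Type*} [Countable ι] [Nonempty ι]
    {G : ι → Set P} (hG : ∀ i, IsUniformized μ h (G i)) : IsUniformized μ h (⋃ i, G i) := by
  choose hS hc using hG
  choose S hSm hSi hSe using hS
  constructor
  · obtain ⟨e, he⟩ := exists_surjective_nat (ι × ℕ)
    refine ⟨fun n => S (e n).1 (e n).2, fun n => hSm _ _, fun n => hSi _ _, ?_⟩
    rw [he.iUnion_comp (fun q => S q.1 q.2), Set.iUnion_prod']
    exact Set.iUnion_congr hSe
  · filter_upwards [ae_all_iff.2 hc] with y hy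
    rw [Set.sdiff_iUnion]
    exact isClosed_iInter hy

variable {P Y : Type*} [TopologicalSpace P] [PolishSpace P] [MeasurableSpace P] [BorelSpace P]
  [TopologicalSpace Y] [PolishSpace Y] [MeasurableSpace Y] [BorelSpace Y]

lemma nullMeasurableSet_image_of_continuous (μ : Measure Y) [IsFiniteMeasure μ] {h : P → Y}
    (hh : Continuous h) {B : Set P} (hB : MeasurableSet B) : NullMeasurableSet (h '' B) μ :=
  (hB.analyticSet.image_of_continuous hh).nullMeasurableSet μ

/-- The complement consists of the `y` whose fibre meets two disjoint basic open sets: a countable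
union of intersections of analytic sets. -/
lemma nullMeasurableSet_setOf_subsingleton_fiber (μ : Measure Y) [IsFiniteMeasure μ] {h : P → Y}
    (hh : Continuous h) {B : Set P} (hB : MeasurableSet B) :
    NullMeasurableSet {y | (h ⁻¹' {y} ∩ B).Subsingleton} μ := by
  have hb := TopologicalSpace.isBasis_countableBasis P
  set 𝓑 := TopologicalSpace.countableBasis P
  have hcount : (𝓑 ×ˢ 𝓑 : Set (Set P × Set P)).Countable :=
    (TopologicalSpace.countable_countableBasis P).prod (TopologicalSpace.countable_countableBasis P)
  have : {y | (h ⁻¹' {y} ∩ B).Subsingleton} =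
      (⋃ q ∈ {q ∈ (𝓑 ×ˢ 𝓑 : Set (Set P × Set P)) | Disjoint q.1 q.2},
        h '' (B ∩ q.1) ∩ h '' (B ∩ q.2))ᶜ := by
    rw [eq_compl_comm]
    ext y
    simp only [Set.mem_iUnion, Set.mem_compl_iff, Set.mem_ofPred_eq, Set.not_subsingleton_iff,
      exists_prop]
    constructor
    · rintro ⟨⟨U, V⟩, ⟨⟨hU, hV⟩, hd⟩, ⟨p, ⟨hpB, hpU⟩, rfl⟩, ⟨q, ⟨hqB, hqV⟩, hq⟩⟩
      refine ⟨p, ⟨rfl, hpB⟩, q, ⟨hq, hqB⟩, ?_⟩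
      rintro rfl
      exact Set.disjoint_left.1 hd hpU hqV
    · rintro ⟨p, ⟨hp, hpB⟩, q, ⟨hq, hqB⟩, hpq⟩
      obtain ⟨U', V', hU', hV', hpU, hqV, hd⟩ := t2_separation hpq
      obtain ⟨U, hU, hpU, hUU⟩ := hb.exists_subset_of_mem_open hpU hU'
      obtain ⟨V, hV, hqV, hVV⟩ := hb.exists_subset_of_mem_open hqV hV'
      exact ⟨(U, V), ⟨⟨hU, hV⟩, hd.mono hUU hVV⟩, ⟨p, ⟨hpB, hpU⟩, hp⟩, ⟨q, ⟨hqB, hqV⟩, hq⟩⟩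
  rw [this]
  refine (NullMeasurableSet.biUnion (hcount.mono fun q hq => hq.1) ?_).compl
  rintro ⟨U, V⟩ ⟨⟨hU, hV⟩, -⟩
  exact (nullMeasurableSet_image_of_continuous μ hh (hB.inter (hb.isOpen hU).measurableSet)).inter
    (nullMeasurableSet_image_of_continuous μ hh (hB.inter (hb.isOpen hV).measurableSet))

/-- A continuous map with countable fibres is, over almost every point, covered by countably many
Borel sets on which it is injective. -/
theorem exists_injOn_cover_of_continuous (μ : Measure Y) [IsFiniteMeasure μ] {h : P → Y}
    (hh : Continuous h) (hcount : ∀ y, (h ⁻¹' {y}).Countable) :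
    ∃ S : ℕ → Set P, (∀ n, MeasurableSet (S n)) ∧ (∀ n, Set.InjOn h (S n)) ∧
      ∀ᵐ y ∂μ, h ⁻¹' {y} ⊆ ⋃ n, S n := by
  -- The empty set is added so that the base is nonempty and can be enumerated by ℕ.
  obtain ⟨b, hbase⟩ : ∃ b : ℕ → Set P, TopologicalSpace.IsTopologicalBasis (Set.range b) := by
    obtain ⟨b, hb⟩ := ((TopologicalSpace.countable_countableBasis P).insert ∅).exists_eq_range
      (Set.insert_nonempty _ _)
    exact ⟨b, hb ▸ (TopologicalSpace.isBasis_countableBasis P).insert_empty⟩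
  have hbo : ∀ t, IsOpen (b t) := fun t => hbase.isOpen ⟨t, rfl⟩
  have hbm : ∀ t, MeasurableSet (b t) := fun t => IsOpen.measurableSet (hbo t)
  have hempty : IsUniformized μ h ∅ :=
    ⟨⟨fun _ => ∅, by simp, by simp, by simp⟩, ae_of_all _ fun y => by
      simpa using (isClosed_singleton.preimage hh)⟩
  -- a set minimising all the measures `μ (h '' (b t \ G))`
  have hmin : ∃ G, IsUniformized μ h G ∧ ∀ G', IsUniformized μ h G' → ∀ t,
      μ (h '' (b t \ G)) ≤ μ (h '' (b t \ G')) := by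
    have : ∀ t, ∃ G : ℕ → Set P, (∀ n, IsUniformized μ h (G n)) ∧ ∀ G', IsUniformized μ h G' →
        μ (h '' (b t \ ⋃ n, G n)) ≤ μ (h '' (b t \ G')) := by
      intro t
      let A : Set ℝ≥0∞ := (fun G => μ (h '' (b t \ G))) '' {G | IsUniformized μ h G}
      obtain ⟨u, -, hu, huA⟩ := exists_seq_tendsto_sInf (S := A) ⟨_, ∅, hempty, rfl⟩
        ⟨0, by simp [lowerBounds]⟩
      choose G hG hGu using huA
      refine ⟨G, hG, fun G' hG' => ?_⟩
      refine (ge_of_tendsto' hu fun n => ?_).trans (sInf_le ⟨G', hG', rfl⟩)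
      rw [← hGu n]
      exact measure_mono (Set.image_mono (Set.sdiff_subset_sdiff_right (Set.subset_iUnion G n)))
    choose G hG hmin using this
    refine ⟨⋃ q : ℕ × ℕ, G q.1 q.2, IsUniformized.iUnion fun q => hG _ _, fun G' hG' t => ?_⟩
    refine le_trans (measure_mono (Set.image_mono (Set.sdiff_subset_sdiff_right ?_))) (hmin t G' hG')
    exact Set.iUnion_subset fun n => Set.subset_iUnion (fun q : ℕ × ℕ => G q.1 q.2) (t, n)
  obtain ⟨G, hG, hGmin⟩ := hmin
  have hGm := hG.measurableSet
  choose Z hZs hZm hZae using fun t =>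
    (nullMeasurableSet_setOf_subsingleton_fiber μ hh
      ((hbm t).diff hGm)).exists_measurable_subset_ae_eq
  -- Enlarge `G` by the points that are alone in their residual fibre within some basic open set.
  -- Minimality of `G` will force the shadows `h '' (b t \ G)` to stay the same up to null sets.
  set G' : Set P := G ∪ ⋃ t, (b t \ G) ∩ h ⁻¹' Z t with hG'def
  have hcapae : ∀ᵐ y ∂μ, ∀ t, y ∈ Z t ↔ (h ⁻¹' {y} ∩ (b t \ G)).Subsingleton :=
    ae_all_iff.2 fun t => (hZae t).mem_iff
  have hG' : IsUniformized μ h G' := by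
    constructor
    · obtain ⟨⟨S, hSm, hSi, hSe⟩, -⟩ := hG
      obtain ⟨e, he⟩ := exists_surjective_nat (ℕ ⊕ ℕ)
      let S' : ℕ ⊕ ℕ → Set P := Sum.elim S fun t => (b t \ G) ∩ h ⁻¹' Z t
      have hm : ∀ q, MeasurableSet (S' q) := by
        rintro (k | t)
        · exact hSm k
        · exact ((hbm t).diff hGm).inter (hh.measurable (hZm t))
      have hi : ∀ q, Set.InjOn h (S' q) := by
        rintro (k | t)
        · exact hSi k
        · rintro p ⟨hp, hpZ⟩ q ⟨hq, -⟩ hpq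
          exact hZs t hpZ ⟨rfl, hp⟩ ⟨hpq.symm, hq⟩
      refine ⟨fun n => S' (e n), fun n => hm _, fun n => hi _, ?_⟩
      · rw [he.iUnion_comp S', Set.iUnion_sum, hG'def]
        exact congrArg₂ _ hSe rfl
    · filter_upwards [hG.2, hcapae] with y hy hyZ
      -- Over a good `y` the enlargement removes only open sets from the closed residual fibre.
      have : h ⁻¹' {y} \ G' = (h ⁻¹' {y} \ G) ∩ ⋂ t ∈ {t | y ∈ Z t}, (b t)ᶜ := by
        ext p
        simp only [hG'def, Set.mem_sdiff, Set.mem_preimage, Set.mem_singleton_iff, Set.mem_union,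
          Set.mem_iUnion, Set.mem_inter_iff, Set.mem_iInter, Set.mem_ofPred_eq, Set.mem_compl_iff]
        constructor
        · rintro ⟨rfl, hp⟩
          push Not at hp
          exact ⟨⟨rfl, hp.1⟩, fun t ht hpt => hp.2 t ⟨hpt, hp.1⟩ ht⟩
        · rintro ⟨⟨rfl, hp⟩, h2⟩
          exact ⟨rfl, by push Not; exact ⟨hp, fun t ht htZ => h2 t htZ ht.1⟩⟩
      rw [this]
      exact hy.inter (isClosed_biInter fun t _ => (hbo t).isClosed_compl)
  have hGG' : G ⊆ G' := Set.subset_union_left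
  have heq : ∀ᵐ y ∂μ, ∀ t, y ∈ h '' (b t \ G') ↔ y ∈ h '' (b t \ G) := by
    refine ae_all_iff.2 fun t => Filter.EventuallyEq.mem_iff ?_
    exact ae_eq_of_subset_of_measure_ge
      (Set.image_mono (Set.sdiff_subset_sdiff_right hGG')) (hGmin G' hG' t)
      (nullMeasurableSet_image_of_continuous μ hh
        ((hbm t).diff hG'.measurableSet)) (measure_ne_top _ _)
  obtain ⟨⟨S, hSm, hSi, hSe⟩, hcl⟩ := hG
  refine ⟨S, hSm, hSi, ?_⟩
  filter_upwards [heq, hcl, hcapae] with y hy hyc hyZ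
  rw [← hSe, ← Set.sdiff_eq_empty]
  by_contra hne
  -- A nonempty residual fibre is closed and countable, so it has an isolated point; a basic set
  -- isolating it contradicts minimality, since `G'` absorbs that point.
  obtain ⟨p, hp, U, hU, hUp⟩ := hyc.exists_isolated_of_countable
    ((hcount y).mono Set.sdiff_subset) (Set.nonempty_iff_ne_empty.2 hne)
  have hpU : p ∈ U := (hUp ▸ Set.mem_singleton p : p ∈ U ∩ _).1
  obtain ⟨_, ⟨t, rfl⟩, hpt, htU⟩ := hbase.exists_subset_of_mem_open hpU hU
  have hsing : ∀ q ∈ h ⁻¹' {y} ∩ (b t \ G), q = p := fun q hq => by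
    have : q ∈ U ∩ (h ⁻¹' {y} \ G) := ⟨htU hq.2.1, hq.1, hq.2.2⟩
    rwa [hUp] at this
  have hyt : y ∈ Z t := (hyZ t).2 fun q hq q' hq' => (hsing q hq).trans (hsing q' hq').symm
  obtain ⟨q, hq, hqy⟩ := (hy t).2 ⟨p, ⟨hpt, hp.2⟩, hp.1⟩
  exact hq.2 (Or.inr (Set.mem_iUnion.2 ⟨t, ⟨hq.1, fun h => hq.2 (hGG' h)⟩,
    by rw [Set.mem_preimage, hqy]; exact hyt⟩))

end LusinNovikov

/-! ### Borel graphs covering the relation, and measurability of the slice measures. -/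

section LusinNovikovMeasurable

/-- A Borel map with countable fibres is, over almost every point, covered by countably many
Borel sets on which it is injective. -/
theorem Measurable.exists_injOn_cover {P Y : Type*} [MeasurableSpace P] [StandardBorelSpace P]
    [MeasurableSpace Y] [StandardBorelSpace Y] (μ : Measure Y) [IsFiniteMeasure μ] {h : P → Y}
    (hh : Measurable h) (hcount : ∀ y, (h ⁻¹' {y}).Countable) :
    ∃ S : ℕ → Set P, (∀ n, MeasurableSet (S n)) ∧ (∀ n, Set.InjOn h (S n)) ∧
      ∀ᵐ y ∂μ, h ⁻¹' {y} ⊆ ⋃ n, S n := by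
  let := upgradeStandardBorel Y
  let tP := upgradeStandardBorel P
  -- A finer Polish topology with the same Borel sets makes `h` continuous.
  obtain ⟨t', hle, hcont, hpol⟩ := hh.exists_continuous
  have hborel : @BorelSpace P t' _ :=
    ⟨(eq_borel_upgradeStandardBorel P).trans
      (borel_eq_borel_of_le hpol tP.toPolishSpace hle).symm⟩
  exact @exists_injOn_cover_of_continuous P Y t' hpol _ hborel _ _ _ _ μ _ h hcont hcount

namespace FeldmanMoore

variable {X : Type*} [MeasurableSpace X] [StandardBorelSpace X] (F : FeldmanMoore X)

lemma rel_refl (x : X) : (x, x) ∈ F.rel := F.equivalence.refl x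

lemma rel_symm {x y : X} (h : (x, y) ∈ F.rel) : (y, x) ∈ F.rel := F.equivalence.symm h

lemma rel_trans {x y z : X} (h : (x, y) ∈ F.rel) (h' : (y, z) ∈ F.rel) : (x, z) ∈ F.rel :=
  F.equivalence.trans h h'

/-- A Feldman-Moore relation is, over almost every point, the union of countably many graphs of
Borel functions. -/
theorem exists_graph_cover : ∃ f : ℕ → X → X, (∀ n, Measurable (f n)) ∧
    (∀ n z, (f n z, z) ∈ F.rel) ∧ ∀ᵐ z ∂F.μ, ∀ x, (x, z) ∈ F.rel → ∃ n, f n z = x := by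
  classical
  have := F.isProbabilityMeasure
  have : StandardBorelSpace F.rel := F.measurableSet_rel.standardBorel
  let h : F.rel → X := fun p => p.1.2
  have hh : Measurable h := measurable_snd.comp measurable_subtype_coe
  have hcount : ∀ y, (h ⁻¹' {y}).Countable := by
    intro y
    refine Set.countable_of_injective_of_countable_image (f := fun p : F.rel => p.1.1) ?_
      ((F.countable_class y).mono ?_)
    · rintro ⟨⟨a, b⟩, hp⟩ h1 ⟨⟨c, d⟩, hq⟩ h2 h3
      simp only [h, Set.mem_preimage, Set.mem_singleton_iff] at h1 h2 h3
      subst h1 h3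
      simp [h2]
    · rintro _ ⟨⟨⟨a, b⟩, hp⟩, h1, rfl⟩
      simp only [h, Set.mem_preimage, Set.mem_singleton_iff] at h1
      subst h1
      exact F.rel_symm hp
  obtain ⟨S, hSm, hSi, hSc⟩ := hh.exists_injOn_cover F.μ hcount
  -- Outside the image of `S n` the value defaults to `z`, so that reflexivity keeps the graph
  -- inside the relation.
  let f : ℕ → X → X := fun n z => if hz : z ∈ h '' S n then (hz.choose).1.1 else z
  have hfS : ∀ n, ∀ p ∈ S n, f n (h p) = p.1.1 := by
    intro n p hp
    have hz : h p ∈ h '' S n := ⟨p, hp, rfl⟩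
    have := hSi n hz.choose_spec.1 hp hz.choose_spec.2
    simp only [f, dif_pos hz]
    rw [this]
  have hfS' : ∀ n z, z ∉ h '' S n → f n z = z := fun n z hz => dif_neg hz
  refine ⟨f, fun n B hB => ?_, fun n z => ?_, ?_⟩
  · have : f n ⁻¹' B = h '' (S n ∩ (fun p : F.rel => p.1.1) ⁻¹' B) ∪ (B \ h '' S n) := by
      ext z
      by_cases hz : z ∈ h '' S n
      · obtain ⟨p, hp, rfl⟩ := hz
        simp only [Set.mem_preimage, hfS n p hp, Set.mem_union, Set.mem_sdiff]
        constructor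
        · exact fun hpB => Or.inl ⟨p, ⟨hp, hpB⟩, rfl⟩
        · rintro (⟨q, ⟨hq, hqB⟩, hqp⟩ | ⟨-, hn⟩)
          · rwa [← hSi n hq hp hqp]
          · exact absurd ⟨p, hp, rfl⟩ hn
      · simp only [Set.mem_preimage, hfS' n z hz, Set.mem_union, Set.mem_sdiff, hz,
          not_false_eq_true, and_true, iff_or_self]
        rintro ⟨q, ⟨hq, -⟩, rfl⟩
        exact absurd ⟨q, hq, rfl⟩ hz
    rw [this]
    refine MeasurableSet.union ?_ (hB.diff ?_)
    · have hBm : MeasurableSet ((fun p : F.rel => p.1.1) ⁻¹' B) :=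
        (measurable_fst.comp measurable_subtype_coe) hB
      -- Lusin–Souslin: injective Borel images of Borel sets are Borel.
      exact ((hSm n).inter hBm).image_of_measurable_injOn hh ((hSi n).mono Set.inter_subset_left)
    · exact (hSm n).image_of_measurable_injOn hh (hSi n)
  · by_cases hz : z ∈ h '' S n
    · obtain ⟨p, hp, rfl⟩ := hz
      rw [hfS n p hp]
      exact p.2
    · rw [hfS' n z hz]
      exact F.rel_refl z
  · filter_upwards [hSc] with z hz x hx
    obtain ⟨n, hn⟩ := Set.mem_iUnion.1 (hz (show (⟨(x, z), hx⟩ : F.rel) ∈ h ⁻¹' {z} from rfl))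
    exact ⟨n, hfS n _ hn⟩

/-- The counting measure on the slice `{x : x ∼ y} × {y}`. -/
noncomputable def sliceMeasure (y : X) : Measure (X × X) :=
  ((Measure.count : Measure X).restrict {x | (x, y) ∈ F.rel}).map fun x => (x, y)

lemma ν_eq_bind : F.ν = F.μ.bind F.sliceMeasure := rfl

lemma sliceMeasure_apply (y : X) {E : Set (X × X)} (hE : MeasurableSet E) :
    F.sliceMeasure y E = Measure.count {x | (x, y) ∈ E ∧ (x, y) ∈ F.rel} := by
  have hm : Measurable fun x : X => (x, y) := measurable_id.prodMk measurable_const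
  rw [sliceMeasure, Measure.map_apply hm hE, Measure.restrict_apply (hm hE)]
  rfl

lemma lintegral_sliceMeasure (y : X) {h : X × X → ℝ≥0∞} (hh : Measurable h) :
    ∫⁻ p, h p ∂F.sliceMeasure y = ∫⁻ x in {x | (x, y) ∈ F.rel}, h (x, y) ∂Measure.count := by
  have hm : Measurable fun x : X => (x, y) := measurable_id.prodMk measurable_const
  rw [sliceMeasure, lintegral_map hh hm]

/-- `Measure.bind` has its intended meaning only for an a.e. measurable family. Almost every slice
measure is a sum of Dirac masses along the covering graphs, made disjoint so that no point is
counted twice. -/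
lemma aemeasurable_sliceMeasure : AEMeasurable F.sliceMeasure F.μ := by
  classical
  obtain ⟨f, hfm, hfr, hfc⟩ := F.exists_graph_cover
  -- the `n`-th graph away from the previous ones
  let Z : ℕ → Set X := fun n => ⋂ m ∈ Finset.range n, {z | f m z ≠ f n z}
  have hZ : ∀ n, MeasurableSet (Z n) := fun n =>
    Finset.measurableSet_biInter _ fun m _ => by
      let := upgradeStandardBorel X
      exact (measurableSet_eq_fun (hfm m) (hfm n)).compl
  let K : X → Measure (X × X) := fun z =>
    Measure.sum fun n => (Z n).indicator (fun z => Measure.dirac (f n z, z)) z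
  have hK : Measurable K := by
    refine Measure.measurable_of_measurable_coe _ fun E hE => ?_
    simp only [K, Measure.sum_apply _ hE]
    refine Measurable.tsum fun n => ?_
    have : (fun z => ((Z n).indicator (fun z => Measure.dirac (f n z, z)) z) E) =
        (Z n ∩ {z | (f n z, z) ∈ E}).indicator fun _ => 1 := by
      ext z
      by_cases hz : z ∈ Z n
      · by_cases hzE : (f n z, z) ∈ E <;> simp [hz, hzE, hE]
      · simp [hz]
    rw [this]
    exact measurable_const.indicator ((hZ n).inter (((hfm n).prodMk measurable_id) hE))
  refine ⟨K, hK, ?_⟩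
  filter_upwards [hfc] with z hz
  ext E hE
  rw [F.sliceMeasure_apply z hE]
  simp only [K, Measure.sum_apply _ hE]
  have hset : {x | (x, z) ∈ E ∧ (x, z) ∈ F.rel} =
      ⋃ n, if z ∈ Z n ∧ (f n z, z) ∈ E then {f n z} else (∅ : Set X) := by
    ext x
    simp only [Set.mem_ofPred_eq, Set.mem_iUnion]
    constructor
    · rintro ⟨hxE, hx⟩
      have hex := hz x hx
      -- The first graph through `(x, z)` is the one that survives the disjointification.
      refine ⟨Nat.find hex, ?_⟩
      have h1 := Nat.find_spec hex
      rw [if_pos]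
      · exact h1.symm
      · rw [h1]
        refine ⟨?_, hxE⟩
        simp only [Z, Set.mem_iInter, Finset.mem_range, Set.mem_ofPred_eq]
        intro m hm
        rw [h1]
        exact Nat.find_min hex hm
    · rintro ⟨n, hn⟩
      split_ifs at hn with h
      · rw [Set.mem_singleton_iff] at hn
        subst hn
        exact ⟨h.2, hfr n z⟩
      · exact hn.elim
  rw [hset, measure_iUnion]
  · refine tsum_congr fun n => ?_
    by_cases hzn : z ∈ Z n
    · by_cases hzE : (f n z, z) ∈ E <;> simp [hzn, hzE, hE]
    · simp [hzn]
  · have key : ∀ m n, m < n → Disjoint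
        (if z ∈ Z m ∧ (f m z, z) ∈ E then {f m z} else (∅ : Set X))
        (if z ∈ Z n ∧ (f n z, z) ∈ E then {f n z} else (∅ : Set X)) := by
      intro m n hmn
      split_ifs with h1 h2
      · have := h2.1
        simp only [Z, Set.mem_iInter, Finset.mem_range, Set.mem_ofPred_eq] at this
        simpa using this m hmn
      all_goals simp
    intro m n hmn
    rcases lt_or_gt_of_ne hmn with h | h
    · exact key m n h
    · exact (key n m h).symm
  · intro n
    split_ifs
    · let := upgradeStandardBorel X
      exact measurableSet_singleton _
    · exact MeasurableSet.empty

end FeldmanMoore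

end LusinNovikovMeasurable

/-! ### Columns of operators and the maps `T ↦ ∑ᵢ Aᵢ T Bᵢ`. -/

section ColumnOperators

variable {G H : Type*} [NormedAddCommGroup G] [InnerProductSpace ℂ G]
  [NormedAddCommGroup H] [InnerProductSpace ℂ H]

/-- The column with entries `S i` defines an operator `G → ℓ²(H)` with squared norm at most `C`. -/
def IsColumnBounded (S : ℕ → (G →L[ℂ] H)) (C : ℝ) : Prop :=
  ∀ (ξ : G) (s : Finset ℕ), ∑ i ∈ s, ‖S i ξ‖ ^ 2 ≤ C * ‖ξ‖ ^ 2

lemma isColumnBounded_of_range {S : ℕ → (G →L[ℂ] H)} {C : ℝ}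
    (h : ∀ (ξ : G) (n : ℕ), ∑ i ∈ Finset.range n, ‖S i ξ‖ ^ 2 ≤ C * ‖ξ‖ ^ 2) :
    IsColumnBounded S C := fun ξ s => by
  obtain ⟨n, hn⟩ := s.exists_nat_subset_range
  exact (Finset.sum_le_sum_of_subset_of_nonneg hn fun _ _ _ => sq_nonneg _).trans (h ξ n)

lemma IsColumnBounded.mono {S : ℕ → (G →L[ℂ] H)} {C D : ℝ} (h : IsColumnBounded S C)
    (hCD : C ≤ D) : IsColumnBounded S D := fun ξ s =>
  (h ξ s).trans (mul_le_mul_of_nonneg_right hCD (sq_nonneg _))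

lemma IsColumnBounded.memℓp {S : ℕ → (G →L[ℂ] H)} {C : ℝ} (h : IsColumnBounded S C) (ξ : G) :
    Memℓp (fun i => S i ξ) 2 :=
  memℓp_gen' (C := C * ‖ξ‖ ^ 2) fun s => by simpa using h ξ s

/-- The operator `ξ ↦ (S i ξ)ᵢ` into `ℓ²(H)`. -/
noncomputable def columnOperator (S : ℕ → (G →L[ℂ] H)) (C : ℝ) (h : IsColumnBounded S C) :
    G →L[ℂ] lp (fun _ : ℕ => H) 2 :=
  LinearMap.mkContinuous
    { toFun := fun ξ => ⟨fun i => S i ξ, h.memℓp ξ⟩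
      map_add' := fun ξ η => by ext i; exact map_add (S i) ξ η
      map_smul' := fun c ξ => by ext i; exact map_smul (S i) c ξ }
    (√C) fun ξ => by
      refine lp.norm_le_of_forall_sum_le (by norm_num) (by positivity) fun s => ?_
      simp only [ENNReal.toReal_ofNat, Real.rpow_ofNat, mul_pow]
      rcases le_or_gt 0 C with hC | hC
      · rw [Real.sq_sqrt hC]
        exact h ξ s
      -- A negative `C` is allowed; then the right side of the column bound is already at most zero.
      · refine (h ξ s).trans ?_
        have := mul_nonneg (sq_nonneg √C) (sq_nonneg ‖ξ‖)
        nlinarith [sq_nonneg ‖ξ‖]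

lemma norm_columnOperator_le (S : ℕ → (G →L[ℂ] H)) (C : ℝ) (h : IsColumnBounded S C) :
    ‖columnOperator S C h‖ ≤ √C :=
  LinearMap.mkContinuous_norm_le _ (Real.sqrt_nonneg _) _

lemma isColumnBounded_amplification (T : H →L[ℂ] H) :
    IsColumnBounded (fun i => T ∘L lp.evalCLM ℂ (fun _ : ℕ => H) 2 i) (‖T‖ ^ 2) := fun ξ s => by
  have : ∀ i ∈ s, ‖T (ξ i)‖ ^ 2 ≤ ‖T‖ ^ 2 * ‖ξ i‖ ^ 2 := fun i _ => by
    rw [← mul_pow]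
    exact pow_le_pow_left₀ (norm_nonneg _) (T.le_opNorm _) 2
  refine (Finset.sum_le_sum this).trans ?_
  rw [← Finset.mul_sum]
  have := lp.sum_rpow_le_norm_rpow (p := 2) (by norm_num) ξ s
  simp only [ENNReal.toReal_ofNat, Real.rpow_ofNat] at this
  exact mul_le_mul_of_nonneg_left this (sq_nonneg _)

/-- The amplification `T ⊗ 1` of an operator to `ℓ²(H)`. -/
noncomputable def amplification (T : H →L[ℂ] H) :
    lp (fun _ : ℕ => H) 2 →L[ℂ] lp (fun _ : ℕ => H) 2 :=
  columnOperator _ _ (isColumnBounded_amplification T)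

lemma amplification_apply (T : H →L[ℂ] H) (ξ : lp (fun _ : ℕ => H) 2) (i : ℕ) :
    amplification T ξ i = T (ξ i) := rfl

lemma norm_amplification_le (T : H →L[ℂ] H) : ‖amplification T‖ ≤ ‖T‖ := by
  refine (norm_columnOperator_le _ _ _).trans ?_
  rw [Real.sqrt_sq (norm_nonneg _)]

lemma summable_norm_mul_norm {H : Type*} [NormedAddCommGroup H]
    (ξ η : lp (fun _ : ℕ => H) 2) :
    Summable fun n => ‖ξ n‖ * ‖η n‖ := by
  have h : ∀ ζ : lp (fun _ : ℕ => H) 2, Summable fun n => ‖ζ n‖ ^ 2 := fun ζ => by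
    simpa using (lp.memℓp ζ).summable (by norm_num)
  refine Summable.of_nonneg_of_le (fun n => by positivity) (fun n => ?_) ((h ξ).add (h η))
  nlinarith [sq_nonneg (‖ξ n‖ - ‖η n‖), sq_nonneg ‖ξ n‖, sq_nonneg ‖η n‖]

lemma sum_norm_mul_norm_le {S : ℕ → (G →L[ℂ] H)} {S' : ℕ → (H →L[ℂ] H)} {C : ℝ} (hC : 0 ≤ C)
    (hS : IsColumnBounded S C)
    (hS' : IsColumnBounded S' C) (ξ : G) (η : H) (s : Finset ℕ) :
    ∑ i ∈ s, ‖S i ξ‖ * ‖S' i η‖ ≤ C * (‖ξ‖ * ‖η‖) := by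
  refine (Real.sum_mul_le_sqrt_mul_sqrt s _ _).trans ?_
  calc √(∑ i ∈ s, ‖S i ξ‖ ^ 2) * √(∑ i ∈ s, ‖S' i η‖ ^ 2)
      ≤ √(C * ‖ξ‖ ^ 2) * √(C * ‖η‖ ^ 2) :=
        mul_le_mul (Real.sqrt_le_sqrt (hS ξ s)) (Real.sqrt_le_sqrt (hS' η s))
          (Real.sqrt_nonneg _) (Real.sqrt_nonneg _)
    _ = C * (‖ξ‖ * ‖η‖) := by
        rw [Real.sqrt_mul hC, Real.sqrt_mul hC, Real.sqrt_sq (norm_nonneg _),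
          Real.sqrt_sq (norm_nonneg _)]
        linear_combination (‖ξ‖ * ‖η‖) * Real.mul_self_sqrt hC

lemma matrixOperator_apply {n : ℕ} (T : Matrix (Fin n) (Fin n) (H →L[ℂ] H))
    (ξ : PiLp 2 fun _ : Fin n => H) (j : Fin n) : matrixOperator T ξ j = ∑ k, T j k (ξ k) := by
  simp [matrixOperator]

lemma matrixOperator_diagonal_apply {n : ℕ} (B : H →L[ℂ] H)
    (ξ : PiLp 2 fun _ : Fin n => H) (j : Fin n) :
    matrixOperator (Matrix.diagonal fun _ => B) ξ j = B (ξ j) := by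
  rw [matrixOperator_apply, Finset.sum_eq_single j] <;> simp +contextual [Matrix.diagonal, eq_comm]

lemma IsColumnBounded.diagonal {S : ℕ → (H →L[ℂ] H)} {C : ℝ}
    (h : IsColumnBounded S C) (n : ℕ) :
    IsColumnBounded (fun i => matrixOperator (Matrix.diagonal fun _ : Fin n => S i)) C := by
  intro ξ s
  simp only [PiLp.norm_sq_eq_of_L2, matrixOperator_diagonal_apply]
  rw [Finset.sum_comm, Finset.mul_sum]
  exact Finset.sum_le_sum fun k _ => h (ξ k) s

variable [CompleteSpace H]

/-- The map `T ↦ ∑ᵢ Aᵢ T Bᵢ` on `B(H)`. -/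
noncomputable def elementaryMap (A B : ℕ → (H →L[ℂ] H)) (C : ℝ)
    (hA : IsColumnBounded (fun i => star (A i)) C) (hB : IsColumnBounded B C) :
    (H →L[ℂ] H) →ₗ[ℂ] (H →L[ℂ] H) where
  -- The row of the `Aᵢ` is the adjoint of the column of the `Aᵢ*`.
  toFun T := (columnOperator _ C hA).adjoint ∘L amplification T ∘L columnOperator B C hB
  map_add' T T' := by
    have : amplification (T + T') = amplification T + amplification T' := by
      ext ξ i; simp [amplification_apply]
    rw [this]; ext; simp
  map_smul' c T := by
    have : amplification (c • T) = c • amplification T := by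
      ext ξ i; simp [amplification_apply]
    rw [this]; ext; simp

variable {A B : ℕ → (H →L[ℂ] H)} {C : ℝ}

lemma elementaryMap_apply (hA : IsColumnBounded (fun i => star (A i)) C)
    (hB : IsColumnBounded B C) (T : H →L[ℂ] H) : elementaryMap A B C hA hB T =
      (columnOperator _ C hA).adjoint ∘L amplification T ∘L columnOperator B C hB := rfl

lemma inner_mul_mul_apply (R T S : H →L[ℂ] H) (ξ η : H) :
    inner ℂ η ((R * T * S) ξ) = inner ℂ (star R η) (T (S ξ)) := by
  rw [ContinuousLinearMap.star_eq_adjoint, ContinuousLinearMap.adjoint_inner_left]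
  rfl

lemma hasSum_inner_elementaryMap (hA : IsColumnBounded (fun i => star (A i)) C)
    (hB : IsColumnBounded B C) (T : H →L[ℂ] H) (ξ η : H) :
    HasSum (fun i => inner ℂ η ((A i * T * B i) ξ))
      (inner ℂ η (elementaryMap A B C hA hB T ξ)) := by
  have := lp.hasSum_inner (𝕜 := ℂ) (columnOperator _ C hA η)
    (amplification T (columnOperator B C hB ξ))
  rw [elementaryMap_apply, ContinuousLinearMap.comp_apply, ContinuousLinearMap.adjoint_inner_right,
    ContinuousLinearMap.comp_apply]
  simp_rw [inner_mul_mul_apply]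
  exact this

lemma norm_elementaryMap_le (hC : 0 ≤ C) (hA : IsColumnBounded (fun i => star (A i)) C)
    (hB : IsColumnBounded B C) (T : H →L[ℂ] H) : ‖elementaryMap A B C hA hB T‖ ≤ C * ‖T‖ := by
  rw [elementaryMap_apply]
  refine (ContinuousLinearMap.opNorm_comp_le _ _).trans ?_
  rw [show C * ‖T‖ = √C * (‖T‖ * √C) by rw [mul_comm ‖T‖, ← mul_assoc, Real.mul_self_sqrt hC]]
  refine mul_le_mul ?_ ?_ (norm_nonneg _) (Real.sqrt_nonneg _)
  · rw [LinearIsometryEquiv.norm_map]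
    exact norm_columnOperator_le _ _ _
  · refine (ContinuousLinearMap.opNorm_comp_le _ _).trans ?_
    exact mul_le_mul (norm_amplification_le T) (norm_columnOperator_le _ _ _) (norm_nonneg _)
      (norm_nonneg _)

lemma norm_inner_mul_mul_le (T : H →L[ℂ] H) (i : ℕ) (ξ η : H) :
    ‖inner ℂ η ((A i * T * B i) ξ)‖ ≤ ‖T‖ * (‖star (A i) η‖ * ‖B i ξ‖) := by
  rw [inner_mul_mul_apply]
  refine (norm_inner_le_norm _ _).trans ?_
  rw [mul_left_comm]
  exact mul_le_mul_of_nonneg_left (T.le_opNorm _) (norm_nonneg _)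

/-- Each vector coefficient converges; Cauchy–Schwarz over `i` bounds all partial sums by `‖T‖ C
‖ηₙ‖ ‖ξₙ‖`, which is summable in `n`, so dominated convergence applies. -/
lemma hasWeakStarSum_elementaryMap (hC : 0 ≤ C) (hA : IsColumnBounded (fun i => star (A i)) C)
    (hB : IsColumnBounded B C) (T : H →L[ℂ] H) :
    HasWeakStarSum (fun i => A i * T * B i) (elementaryMap A B C hA hB T) := by
  intro ξ η
  refine tendsto_tsum_of_dominated_convergence
    (bound := fun n => ‖T‖ * C * (‖η n‖ * ‖ξ n‖)) ((summable_norm_mul_norm η ξ).mul_left _) ?_ ?_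
  · intro n
    have := (hasSum_inner_elementaryMap hA hB T (ξ n) (η n)).tendsto_sum_nat
    refine this.congr fun N => ?_
    rw [sum_apply, inner_sum]
  · refine Eventually.of_forall fun N n => ?_
    rw [sum_apply, inner_sum]
    refine (norm_sum_le _ _).trans ((Finset.sum_le_sum fun i _ =>
      norm_inner_mul_mul_le T i (ξ n) (η n)).trans ?_)
    rw [← Finset.mul_sum, mul_assoc]
    exact mul_le_mul_of_nonneg_left (sum_norm_mul_norm_le hC hA hB _ _ _) (norm_nonneg _)

/-! ### Complete boundedness -/

lemma star_matrixOperator_diagonal {n : ℕ} (B : H →L[ℂ] H) :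
    star (matrixOperator (Matrix.diagonal fun _ : Fin n => B)) =
      matrixOperator (Matrix.diagonal fun _ : Fin n => star B) := by
  rw [ContinuousLinearMap.star_eq_adjoint, eq_comm, ContinuousLinearMap.eq_adjoint_iff]
  intro ξ η
  simp only [PiLp.inner_apply, matrixOperator_diagonal_apply, ContinuousLinearMap.star_eq_adjoint,
    ContinuousLinearMap.adjoint_inner_left]

/-- The amplification to `n × n` matrices is again an elementary map, with coefficients the diagonal
matrices of the `Aᵢ` and `Bᵢ`. Diagonal columns keep the constant `C`, so the bound is uniform in
`n`. -/
lemma isCompletelyBounded_elementaryMap (hC : 0 ≤ C)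
    (hA : IsColumnBounded (fun i => star (A i)) C) (hB : IsColumnBounded B C) :
    IsCompletelyBounded (elementaryMap A B C hA hB) := by
  refine ⟨C, fun n T => ?_⟩
  have hA' : IsColumnBounded
      (fun i => star (matrixOperator (Matrix.diagonal fun _ : Fin n => A i))) C := by
    simpa only [star_matrixOperator_diagonal] using hA.diagonal n
  have hB' := hB.diagonal n
  have : matrixOperator (T.map (elementaryMap A B C hA hB)) =
      elementaryMap _ _ C hA' hB' (matrixOperator T) := by
    refine ContinuousLinearMap.ext fun ξ => ext_inner_left ℂ fun η => ?_
    refine HasSum.unique ?_ (hasSum_inner_elementaryMap hA' hB' (matrixOperator T) ξ η)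
    have key : ∀ i, inner ℂ η ((matrixOperator (Matrix.diagonal fun _ : Fin n => A i) *
        matrixOperator T * matrixOperator (Matrix.diagonal fun _ : Fin n => B i)) ξ) =
        ∑ j, ∑ k, inner ℂ (η j) ((A i * T j k * B i) (ξ k)) := fun i => by
      rw [inner_mul_mul_apply, star_matrixOperator_diagonal, PiLp.inner_apply]
      simp only [matrixOperator_diagonal_apply, matrixOperator_apply T, inner_sum,
        inner_mul_mul_apply]
    simp only [key, PiLp.inner_apply, matrixOperator_apply, Matrix.map_apply, inner_sum]
    exact hasSum_sum fun j _ => hasSum_sum fun k _ => hasSum_inner_elementaryMap hA hB _ _ _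
  rw [this]
  exact norm_elementaryMap_le hC hA' hB' _

end ColumnOperators

/-! ### The map induced by an element of the tensor product. -/

section EhSeries

variable {H : Type*} [NormedAddCommGroup H] [InnerProductSpace ℂ H] [CompleteSpace H]

lemma normalFunctional_single {H : Type*} [NormedAddCommGroup H] [InnerProductSpace ℂ H]
    (ξ η : H) (T : H →L[ℂ] H) :
    normalFunctional (lp.single 2 0 ξ) (lp.single 2 0 η) T = inner ℂ η (T ξ) := by
  rw [normalFunctional, tsum_eq_single 0]
  · simp
  · intro n hn
    simp [Pi.single_eq_of_ne hn]

/-- Tested at `ξ`, the partial sums `∑ ‖Sᵢ ξ‖²` increase to `⟨R ξ, ξ⟩`, which is at most `‖R‖ ‖ξ‖²`.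
-/
lemma isColumnBounded_of_hasWeakStarSum {S : ℕ → (H →L[ℂ] H)} {R : H →L[ℂ] H}
    (h : HasWeakStarSum (fun i => star (S i) * S i) R) : IsColumnBounded S ‖R‖ := by
  refine isColumnBounded_of_range fun ξ n => ?_
  have hlim := (Complex.continuous_re.tendsto _).comp (h (lp.single 2 0 ξ) (lp.single 2 0 ξ))
  have heq : ∀ n, (normalFunctional (lp.single 2 0 ξ) (lp.single 2 0 ξ)
      (∑ i ∈ Finset.range n, star (S i) * S i)).re = ∑ i ∈ Finset.range n, ‖S i ξ‖ ^ 2 := by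
    intro n
    rw [normalFunctional_single, sum_apply, inner_sum, Complex.re_sum]
    refine Finset.sum_congr rfl fun i _ => ?_
    rw [ContinuousLinearMap.star_eq_adjoint, mul_apply_eq_comp,
      ContinuousLinearMap.adjoint_inner_right]
    exact (norm_sq_eq_re_inner (𝕜 := ℂ) _).symm
  have hmono : Monotone fun n => ∑ i ∈ Finset.range n, ‖S i ξ‖ ^ 2 :=
    monotone_nat_of_le_succ fun n => by
      rw [Finset.sum_range_succ]
      exact le_add_of_nonneg_right (sq_nonneg _)
  refine (hmono.ge_of_tendsto (hlim.congr heq) n).trans ?_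
  rw [normalFunctional_single]
  refine (Complex.re_le_norm _).trans ((norm_inner_le_norm _ _).trans ?_)
  nlinarith [R.le_opNorm ξ, norm_nonneg ξ]

variable {𝒜 : Set (H →L[ℂ] H)}

lemma EhSeries.isColumnBounded_A (w : EhSeries 𝒜) :
    IsColumnBounded (fun i => star (w.A i)) ‖w.row‖ :=
  isColumnBounded_of_hasWeakStarSum (by simpa only [star_star] using w.hasSum_row)

lemma EhSeries.isColumnBounded_B (w : EhSeries 𝒜) : IsColumnBounded w.B ‖w.col‖ :=
  isColumnBounded_of_hasWeakStarSum w.hasSum_col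

/-- The map `T ↦ ∑ᵢ Aᵢ T Bᵢ` of a series. -/
noncomputable def EhSeries.map (w : EhSeries 𝒜) : (H →L[ℂ] H) →ₗ[ℂ] (H →L[ℂ] H) :=
  elementaryMap w.A w.B (max ‖w.row‖ ‖w.col‖) (w.isColumnBounded_A.mono (le_max_left _ _))
    (w.isColumnBounded_B.mono (le_max_right _ _))

lemma EhSeries.hasSum_inner_map (w : EhSeries 𝒜) (T : H →L[ℂ] H) (ξ η : H) :
    HasSum (fun i => inner ℂ η ((w.A i * T * w.B i) ξ)) (inner ℂ η (w.map T ξ)) :=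
  hasSum_inner_elementaryMap _ _ T ξ η

lemma EhSeries.hasWeakStarSum_map (w : EhSeries 𝒜) (T : H →L[ℂ] H) :
    HasWeakStarSum (fun i => w.A i * T * w.B i) (w.map T) :=
  hasWeakStarSum_elementaryMap (le_max_of_le_left (norm_nonneg _)) _ _ T

lemma EhSeries.isCompletelyBounded_map (w : EhSeries 𝒜) : IsCompletelyBounded w.map :=
  isCompletelyBounded_elementaryMap (le_max_of_le_left (norm_nonneg _)) _ _

lemma EhSeries.norm_map_le (w : EhSeries 𝒜) (T : H →L[ℂ] H) :
    ‖w.map T‖ ≤ max ‖w.row‖ ‖w.col‖ * ‖T‖ :=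
  norm_elementaryMap_le (le_max_of_le_left (norm_nonneg _)) _ _ T

lemma tsum_inner_mul_inner_eq {u : EhTensor 𝒜} {v w : EhSeries 𝒜} (hv : EhTensor.Represents v u)
    (hw : EhTensor.Represents w u) (ξ η ξ' η' : H) :
    ∑' i, inner ℂ η (v.A i ξ) * inner ℂ η' (v.B i ξ') =
      ∑' i, inner ℂ η (w.A i ξ) * inner ℂ η' (w.B i ξ') := by
  have := Quotient.exact (hv.trans hw.symm) (lp.single 2 0 ξ) (lp.single 2 0 η)
    (lp.single 2 0 ξ') (lp.single 2 0 η')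
  simpa only [normalFunctional_single] using this

/-- The partial sums of the expansion of a vector in an orthonormal family. -/
lemma norm_sum_inner_smul_le {H : Type*} [NormedAddCommGroup H] [InnerProductSpace ℂ H]
    {ι : Type*} {b : ι → H} (hb : Orthonormal ℂ b) (s : Finset ι) (y : H) :
    ‖∑ k ∈ s, (inner ℂ (b k) y : ℂ) • b k‖ ≤ ‖y‖ := by
  rw [← sq_le_sq₀ (norm_nonneg _) (norm_nonneg _)]
  refine le_trans (le_of_eq ?_) (hb.sum_inner_products_le y (s := s))
  rw [← Complex.ofReal_inj]
  push_cast
  refine (inner_self_eq_norm_sq_to_K (𝕜 := ℂ) (∑ k ∈ s, (inner ℂ (b k) y : ℂ) • b k)).symm.trans ?_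
  rw [hb.inner_sum]
  exact Finset.sum_congr rfl fun i _ => Complex.conj_mul' _

/-- Expand `Bᵢ ξ` in the basis and exchange the sums over `i` and `k`. For fixed `k` the inner sum
is the bilinear form of the series at two vector functionals, so the limit depends only on the
element represented. Bessel's inequality bounds the finite expansions uniformly, which justifies the
exchange by dominated convergence. -/
lemma EhSeries.tendsto_tsum_inner_sum (w : EhSeries 𝒜) {ι : Type*} (b : HilbertBasis ι ℂ H)
    (T : H →L[ℂ] H) (ξ η : H) :
    Tendsto (fun s : Finset ι => ∑ k ∈ s,
      ∑' i, inner ℂ η (w.A i (T (b k))) * inner ℂ (b k) (w.B i ξ)) atTop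
      (𝓝 (inner ℂ η (w.map T ξ))) := by
  set C := max ‖w.row‖ ‖w.col‖
  have hC : 0 ≤ C := le_max_of_le_left (norm_nonneg _)
  have hA := w.isColumnBounded_A.mono (le_max_left _ ‖w.col‖)
  have hB := w.isColumnBounded_B.mono (le_max_right ‖w.row‖ _)
  have hsum : Summable fun i => ‖star (w.A i) η‖ * ‖w.B i ξ‖ :=
    summable_of_sum_le (fun i => by positivity) fun s => sum_norm_mul_norm_le hC hA hB η ξ s
  have hinner : ∀ i ζ, inner ℂ η (w.A i ζ) = inner ℂ (star (w.A i) η) ζ := fun i ζ => by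
    rw [ContinuousLinearMap.star_eq_adjoint, ContinuousLinearMap.adjoint_inner_left]
  have hbound : ∀ (y : H) (s : Finset ι) (i : ℕ),
      ‖inner ℂ η (w.A i (T (∑ k ∈ s, (inner ℂ (b k) y : ℂ) • b k)))‖ ≤
        ‖T‖ * (‖star (w.A i) η‖ * ‖y‖) := fun y s i => by
    rw [hinner]
    refine (norm_inner_le_norm _ _).trans ?_
    rw [mul_left_comm]
    refine mul_le_mul_of_nonneg_left ((T.le_opNorm _).trans ?_) (norm_nonneg _)
    exact mul_le_mul_of_nonneg_left (norm_sum_inner_smul_le b.orthonormal s y) (norm_nonneg _)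
  have hterm : ∀ (s : Finset ι) (i : ℕ),
      inner ℂ η (w.A i (T (∑ k ∈ s, (inner ℂ (b k) (w.B i ξ) : ℂ) • b k))) =
        ∑ k ∈ s, inner ℂ η (w.A i (T (b k))) * inner ℂ (b k) (w.B i ξ) := fun s i => by
    simp only [map_sum, map_smul, inner_sum, inner_smul_right]
    exact Finset.sum_congr rfl fun k _ => mul_comm _ _
  have hsumm : ∀ k, Summable fun i => inner ℂ η (w.A i (T (b k))) * inner ℂ (b k) (w.B i ξ) := by
    intro k
    refine Summable.of_norm_bounded (hsum.mul_left ‖T‖) fun i => ?_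
    have := hterm {k} i
    simp only [Finset.sum_singleton] at this
    rw [← this, ← Finset.sum_singleton (fun k => (inner ℂ (b k) (w.B i ξ) : ℂ) • b k) k]
    exact hbound _ _ _
  have hlim : Tendsto (fun s : Finset ι => ∑' i,
      inner ℂ η (w.A i (T (∑ k ∈ s, (inner ℂ (b k) (w.B i ξ) : ℂ) • b k)))) atTop
      (𝓝 (∑' i, inner ℂ η (w.A i (T (w.B i ξ))))) := by
    refine tendsto_tsum_of_dominated_convergence (hsum.mul_left ‖T‖) (fun i => ?_)
      (Eventually.of_forall fun s i => hbound _ _ _)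
    have h1 : Tendsto (fun s : Finset ι => ∑ k ∈ s, (inner ℂ (b k) (w.B i ξ) : ℂ) • b k) atTop
        (𝓝 (w.B i ξ)) := by
      have := b.hasSum_repr (w.B i ξ)
      simp only [b.repr_apply_apply] at this
      exact this
    exact (((innerSL ℂ η) ∘L (w.A i) ∘L T).continuous.tendsto _).comp h1
  rw [← (w.hasSum_inner_map T ξ η).tsum_eq]
  refine hlim.congr fun s => ?_
  simp_rw [hterm]
  exact Summable.tsum_finsetSum fun k _ => hsumm k

/-- The induced map does not depend on the series. -/
lemma EhSeries.map_eq_of_represents {u : EhTensor 𝒜} {v w : EhSeries 𝒜}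
    (hv : EhTensor.Represents v u) (hw : EhTensor.Represents w u) : v.map = w.map := by
  refine LinearMap.ext fun T => ContinuousLinearMap.ext fun ξ => ext_inner_left ℂ fun η => ?_
  obtain ⟨_, b, -⟩ := exists_hilbertBasis ℂ H
  refine tendsto_nhds_unique (v.tendsto_tsum_inner_sum b T ξ η) ?_
  simp_rw [tsum_inner_mul_inner_eq hv hw]
  exact w.tendsto_tsum_inner_sum b T ξ η

lemma EhSeries.isInducedMap_map {u : EhTensor 𝒜} {w : EhSeries 𝒜}
    (hw : EhTensor.Represents w u) : u.IsInducedMap w.map := fun v hv T => by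
  rw [← EhSeries.map_eq_of_represents hv hw]
  exact v.hasWeakStarSum_map T

/-- All representing series induce the same map, so the estimate of each one applies and the infimum
may be taken. -/
lemma EhTensor.norm_map_le {u : EhTensor 𝒜} {w : EhSeries 𝒜}
    (hw : EhTensor.Represents w u) (T : H →L[ℂ] H) : ‖w.map T‖ ≤ u.ehNorm * ‖T‖ := by
  rcases (norm_nonneg T).eq_or_lt with h | h
  · rw [← h, norm_eq_zero.1 h.symm]; simp
  rw [← div_le_iff₀ h]
  refine le_csInf ⟨_, w, hw, le_max_left ‖w.row‖ ‖w.col‖, le_max_right _ _⟩ ?_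
  rintro C ⟨v, hv, hrow, hcol⟩
  rw [div_le_iff₀ h, EhSeries.map_eq_of_represents hw hv]
  exact (v.norm_map_le T).trans (mul_le_mul_of_nonneg_right (max_le hrow hcol) h.le)

lemma EhTensor.ehNorm_nonneg (u : EhTensor 𝒜) : 0 ≤ u.ehNorm :=
  Real.sInf_nonneg fun _ ⟨_, _, h, _⟩ => (norm_nonneg _).trans h

lemma EhTensor.exists_represents (u : EhTensor 𝒜) : ∃ w, EhTensor.Represents w u :=
  Quotient.exists_rep u

end EhSeries

namespace FeldmanMoore

variable {X : Type*} [MeasurableSpace X] [StandardBorelSpace X] (F : FeldmanMoore X)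

/-! ### The counting measure of a Feldman-Moore relation -/

lemma forall_rel_of_ae_sliceMeasure {P : X × X → Prop} {z : X}
    (h : ∀ᵐ p ∂F.sliceMeasure z, P p) : ∀ x, (x, z) ∈ F.rel → P (x, z) := by
  intro x hx
  by_contra hP
  have h0 : F.sliceMeasure z (toMeasurable (F.sliceMeasure z) {p | ¬ P p}) = 0 := by
    rw [measure_toMeasurable]; exact h
  rw [F.sliceMeasure_apply z (measurableSet_toMeasurable _ _), Measure.count_eq_zero_iff] at h0
  exact (h0 ▸ (⟨subset_toMeasurable _ _ hP, hx⟩ : x ∈ {x | (x, z) ∈ _ ∧ (x, z) ∈ F.rel}) :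
    x ∈ (∅ : Set X))

/-- A null set for a counting measure is empty, so a ν-a.e. property holds on entire slices. `P`
need not be measurable: for the converse the exceptional set is covered by a Borel null set of base
points together with the complement of the relation. -/
lemma ae_ν_iff {P : X × X → Prop} :
    (∀ᵐ p ∂F.ν, P p) ↔ ∀ᵐ z ∂F.μ, ∀ x, (x, z) ∈ F.rel → P (x, z) := by
  constructor
  · intro h
    filter_upwards [Measure.ae_ae_of_ae_bind F.aemeasurable_sliceMeasure h] with z hz
    exact F.forall_rel_of_ae_sliceMeasure hz
  · intro h
    set N := toMeasurable F.μ {z | ¬ ∀ x, (x, z) ∈ F.rel → P (x, z)}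
    have hN0 : F.μ N = 0 := by rw [measure_toMeasurable]; exact h
    have hN : MeasurableSet N := measurableSet_toMeasurable _ _
    have hE : MeasurableSet (Prod.snd ⁻¹' N ∪ F.relᶜ) :=
      (measurable_snd hN).union F.measurableSet_rel.compl
    refine measure_mono_null (t := Prod.snd ⁻¹' N ∪ F.relᶜ) ?_ ?_
    · rintro ⟨x, z⟩ hp
      by_cases hR : (x, z) ∈ F.rel
      · exact Or.inl (subset_toMeasurable _ _ fun hz => hp (hz x hR))
      · exact Or.inr hR
    · refine le_antisymm ((Measure.bind_apply_le _ hE).trans (le_of_eq ?_)) zero_le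
      have : ∀ᵐ z ∂F.μ, z ∉ N := measure_eq_zero_iff_ae_notMem.1 hN0
      rw [lintegral_congr_ae (g := fun _ => 0), lintegral_zero]
      filter_upwards [this] with z hz
      change F.sliceMeasure z _ = 0
      rw [F.sliceMeasure_apply z hE, Measure.count_eq_zero_iff, Set.eq_empty_iff_forall_notMem]
      rintro x ⟨hx | hx, hR⟩
      · exact hz hx
      · exact hx hR

lemma ae_mem_rel : ∀ᵐ p ∂F.ν, p ∈ F.rel := F.ae_ν_iff.2 (ae_of_all _ fun _ _ h => h)

/-- By quasi-invariance, a property of almost every point holds on almost every class. -/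
lemma ae_forall_rel {P : X → Prop} (h : ∀ᵐ z ∂F.μ, P z) :
    ∀ᵐ z ∂F.μ, ∀ x, (x, z) ∈ F.rel → P x := by
  set N := toMeasurable F.μ {z | ¬ P z}
  have hN0 : F.μ N = 0 := by rw [measure_toMeasurable]; exact h
  have := (F.quasiInvariant N (measurableSet_toMeasurable _ _)).1 hN0
  refine measure_mono_null ?_ this
  intro z hz
  simp only [Set.mem_compl_iff, Set.mem_ofPred_eq, not_forall] at hz ⊢
  obtain ⟨x, hx, hP⟩ := hz
  exact ⟨x, subset_toMeasurable _ _ hP, hx⟩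

lemma ae_ν_fst {P : X → Prop} (h : ∀ᵐ z ∂F.μ, P z) : ∀ᵐ p ∂F.ν, P p.1 :=
  F.ae_ν_iff.2 (F.ae_forall_rel h)

lemma ae_ν_snd {P : X → Prop} (h : ∀ᵐ z ∂F.μ, P z) : ∀ᵐ p ∂F.ν, P p.2 :=
  F.ae_ν_iff.2 (h.mono fun _ hz _ _ => hz)

variable {f : X → X}

lemma quasiMeasurePreserving (hf : Measurable f) (hfr : ∀ z, (f z, z) ∈ F.rel) :
    Measure.QuasiMeasurePreserving f F.μ F.μ :=
  ⟨hf, Measure.AbsolutelyContinuous.mk fun s hs h0 => by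
    rw [Measure.map_apply hf hs]
    refine measure_mono_null ?_ ((F.quasiInvariant s hs).1 h0)
    exact fun z hz => ⟨f z, hz, hfr z⟩⟩

lemma aemeasurable_lintegral_sliceMeasure {h : X × X → ℝ≥0∞} (hh : Measurable h) :
    AEMeasurable (fun z => ∫⁻ p, h p ∂F.sliceMeasure z) F.μ :=
  (Measure.measurable_lintegral hh).comp_aemeasurable F.aemeasurable_sliceMeasure

lemma lintegral_ν {h : X × X → ℝ≥0∞} (hh : Measurable h) :
    ∫⁻ p, h p ∂F.ν = ∫⁻ z, ∫⁻ p, h p ∂F.sliceMeasure z ∂F.μ := by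
  rw [ν_eq_bind, Measure.lintegral_bind F.aemeasurable_sliceMeasure hh.aemeasurable]

/-- The graph `{(f z, z)}`. -/
def graph (f : X → X) : Set (X × X) := {p | p.1 = f p.2}

lemma measurableSet_graph (hf : Measurable f) :
    MeasurableSet (graph f) := by
  let := upgradeStandardBorel X
  exact measurableSet_eq_fun measurable_fst (hf.comp measurable_snd)

lemma restrict_graph (hf : Measurable f) (hfr : ∀ z, (f z, z) ∈ F.rel) :
    F.ν.restrict (graph f) = F.μ.map fun z => (f z, z) := by
  have hm : Measurable fun z => (f z, z) := hf.prodMk measurable_id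
  ext E hE
  rw [Measure.restrict_apply hE, Measure.map_apply hm hE, ν_eq_bind,
    Measure.bind_apply (hE.inter (measurableSet_graph hf)) F.aemeasurable_sliceMeasure,
    ← lintegral_indicator_one (hm hE)]
  refine lintegral_congr fun z => ?_
  rw [F.sliceMeasure_apply z (hE.inter (measurableSet_graph hf))]
  by_cases hz : (f z, z) ∈ E
  · have : {x | (x, z) ∈ E ∩ graph f ∧ (x, z) ∈ F.rel} = {f z} := by
      ext x
      constructor
      · rintro ⟨⟨-, h⟩, -⟩; exact h
      · rintro rfl; exact ⟨⟨hz, rfl⟩, hfr z⟩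
    rw [this, Measure.count_singleton, Set.indicator_of_mem (by exact hz)]
    rfl
  · have : {x | (x, z) ∈ E ∩ graph f ∧ (x, z) ∈ F.rel} = ∅ := by
      rw [Set.eq_empty_iff_forall_notMem]
      rintro x ⟨⟨hE, h⟩, -⟩
      obtain rfl : x = f z := h
      exact hz hE
    rw [this, measure_empty, Set.indicator_of_notMem (by exact hz)]

/-- The density of the image under `f` of the restriction of `μ` to `d`. -/
noncomputable def density (f : X → X) (d : Set X) : X → ℝ≥0∞ :=
  ((F.μ.restrict d).map f).rnDeriv F.μ

lemma measurable_density (f : X → X) (d : Set X) : Measurable (F.density f d) :=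
  Measure.measurable_rnDeriv _ _

lemma map_restrict_absolutelyContinuous (hf : Measurable f) (hfr : ∀ z, (f z, z) ∈ F.rel)
    (d : Set X) : (F.μ.restrict d).map f ≪ F.μ :=
  (Measure.map_mono Measure.restrict_le_self hf).absolutelyContinuous.trans
    (F.quasiMeasurePreserving hf hfr).absolutelyContinuous

lemma withDensity_density (hf : Measurable f) (hfr : ∀ z, (f z, z) ∈ F.rel)
    (d : Set X) : F.μ.withDensity (F.density f d) = (F.μ.restrict d).map f := by
  have := F.isProbabilityMeasure
  have : IsFiniteMeasure ((F.μ.restrict d).map f) := inferInstance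
  exact Measure.withDensity_rnDeriv_eq _ _ (F.map_restrict_absolutelyContinuous hf hfr d)

lemma density_lt_top (f : X → X) (d : Set X) : ∀ᵐ z ∂F.μ, F.density f d z < ∞ := by
  have := F.isProbabilityMeasure
  exact Measure.rnDeriv_lt_top _ _

lemma lintegral_sliceMeasure_comp (hf : Measurable f) (hfr : ∀ z, (f z, z) ∈ F.rel)
    {h : X × X → ℝ≥0∞} (hh : Measurable h) (z : X) :
    ∫⁻ p, h (p.1, f p.2) ∂F.sliceMeasure z = ∫⁻ p, h p ∂F.sliceMeasure (f z) := by
  have : Measurable fun p : X × X => (p.1, f p.2) :=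
    measurable_fst.prodMk (hf.comp measurable_snd)
  rw [F.lintegral_sliceMeasure z (h := fun p => h (p.1, f p.2)) (hh.comp this),
    F.lintegral_sliceMeasure _ hh]
  have : {x | (x, z) ∈ F.rel} = {x | (x, f z) ∈ F.rel} := by
    ext x
    exact ⟨fun h => F.rel_trans h (F.rel_symm (hfr z)), fun h => F.rel_trans h (hfr z)⟩
  rw [this]

/-- Change of variables in the right coordinate. -/
lemma lintegral_comp_right (hf : Measurable f) (hfr : ∀ z, (f z, z) ∈ F.rel) {d : Set X}
    (hd : MeasurableSet d) {h : X × X → ℝ≥0∞} (hh : Measurable h) :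
    ∫⁻ p, d.indicator 1 p.2 * h (p.1, f p.2) ∂F.ν =
      ∫⁻ p, F.density f d p.2 * h p ∂F.ν := by
  have hΦ : Measurable fun p : X × X => (p.1, f p.2) :=
    measurable_fst.prodMk (hf.comp measurable_snd)
  have hd1 : Measurable (d.indicator (1 : X → ℝ≥0∞)) := measurable_one.indicator hd
  have hconst : ∀ (c : X → ℝ≥0∞) (g : X × X → ℝ≥0∞), Measurable c → Measurable g → ∀ z,
      ∫⁻ p, c p.2 * g p ∂F.sliceMeasure z = c z * ∫⁻ p, g p ∂F.sliceMeasure z := by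
    intro c g hc hg z
    rw [F.lintegral_sliceMeasure z (h := fun p => c p.2 * g p)
      ((hc.comp measurable_snd).mul hg), F.lintegral_sliceMeasure z hg]
    have hz : Measurable fun x : X => (x, z) := measurable_id.prodMk measurable_const
    exact lintegral_const_mul (c z) (f := fun x => g (x, z)) (hg.comp hz)
  rw [F.lintegral_ν (h := fun p => d.indicator 1 p.2 * h (p.1, f p.2))
      ((hd1.comp measurable_snd).mul (hh.comp hΦ)),
    F.lintegral_ν (h := fun p => F.density f d p.2 * h p)
      (((F.measurable_density f d).comp measurable_snd).mul hh)]
  have hae := F.aemeasurable_lintegral_sliceMeasure hh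
  -- The points `z` and `f z` have the same class, so `f` moves only the base point; what remains is
  -- a change of variables for μ, with the Radon–Nikodym derivative as Jacobian.
  calc _ = ∫⁻ z, d.indicator (fun z => ∫⁻ p, h p ∂F.sliceMeasure (f z)) z ∂F.μ := by
        refine lintegral_congr fun z => ?_
        refine (hconst _ _ hd1 (hh.comp hΦ) z).trans ?_
        change _ * ∫⁻ p, h (p.1, f p.2) ∂F.sliceMeasure z = _
        rw [F.lintegral_sliceMeasure_comp hf hfr hh z]
        by_cases hz : z ∈ d <;> simp [hz]
    _ = ∫⁻ z, ∫⁻ p, h p ∂F.sliceMeasure z ∂((F.μ.restrict d).map f) := by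
        rw [lintegral_indicator hd, lintegral_map'
          (hae.mono_ac (F.map_restrict_absolutelyContinuous hf hfr d)) hf.aemeasurable]
    _ = ∫⁻ z, F.density f d z * ∫⁻ p, h p ∂F.sliceMeasure z ∂F.μ := by
        rw [← F.withDensity_density hf hfr d, lintegral_withDensity_eq_lintegral_mul₀
          (F.measurable_density f d).aemeasurable hae]
        rfl
    _ = _ := lintegral_congr fun z => (hconst _ _ (F.measurable_density f d) hh z).symm

end FeldmanMoore

/-! ### Multiplication operators on L². -/

section Multiplication

variable {Z : Type*} [MeasurableSpace Z] {m : Measure Z}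

/-- `S` is the multiplication by the function `b` on `L²`. -/
def IsMultiplication (b : Z → ℂ) (S : Lp ℂ 2 m →L[ℂ] Lp ℂ 2 m) : Prop :=
  ∀ ξ : Lp ℂ 2 m, S ξ =ᵐ[m] fun p => b p * ξ p

/-- Multiplication by an element of `L^∞`. -/
noncomputable def multiplication (φ : Lp ℂ ∞ m) : Lp ℂ 2 m →L[ℂ] Lp ℂ 2 m :=
  (ContinuousLinearMap.lsmul ℂ ℂ).holderL m ∞ 2 2 φ

lemma multiplication_apply (φ : Lp ℂ ∞ m) (ξ : Lp ℂ 2 m) :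
    multiplication φ ξ = (φ • ξ : Lp ℂ 2 m) := rfl

lemma isMultiplication_multiplication (φ : Lp ℂ ∞ m) :
    IsMultiplication φ (multiplication φ) := fun ξ => by
  rw [multiplication_apply]
  filter_upwards [Lp.coeFn_lpSMul (r := 2) φ ξ] with p hp
  rw [hp]
  rfl

lemma IsMultiplication.congr {b b' : Z → ℂ} {S : Lp ℂ 2 m →L[ℂ] Lp ℂ 2 m}
    (h : IsMultiplication b S) (hb : b =ᵐ[m] b') : IsMultiplication b' S := fun ξ => by
  filter_upwards [h ξ, hb] with p hp hbp
  rw [hp, hbp]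

lemma exists_isMultiplication {b : Z → ℂ} (hb : Measurable b) {C : ℝ} (hC : ∀ p, ‖b p‖ ≤ C) :
    ∃ S : Lp ℂ 2 m →L[ℂ] Lp ℂ 2 m, IsMultiplication b S :=
  ⟨_, (isMultiplication_multiplication ((memLp_top_of_bound hb.aestronglyMeasurable C
    (ae_of_all _ hC)).toLp b)).congr (MemLp.coeFn_toLp _)⟩

lemma IsMultiplication.unique {b : Z → ℂ} {S S' : Lp ℂ 2 m →L[ℂ] Lp ℂ 2 m}
    (h : IsMultiplication b S) (h' : IsMultiplication b S') : S = S' :=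
  ContinuousLinearMap.ext fun ξ => Lp.ext ((h ξ).trans (h' ξ).symm)

lemma IsMultiplication.conj {b : Z → ℂ} (hb : Measurable b) {C : ℝ} (hC : ∀ p, ‖b p‖ ≤ C)
    {S : Lp ℂ 2 m →L[ℂ] Lp ℂ 2 m} (h : IsMultiplication b S) :
    IsMultiplication (fun p => star (b p)) (star S) := by
  obtain ⟨S', hS'⟩ := exists_isMultiplication (m := m) (b := fun p => star (b p)) (C := C)
    (continuous_star.measurable.comp hb) (fun p => by rw [norm_star]; exact hC p)
  have : S' = star S := by
    rw [ContinuousLinearMap.star_eq_adjoint, ContinuousLinearMap.eq_adjoint_iff]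
    intro ξ η
    rw [L2.inner_def, L2.inner_def]
    refine integral_congr_ae ?_
    filter_upwards [h η, hS' ξ] with p hp hp'
    rw [hp, hp']
    simp only [RCLike.inner_apply, map_mul, RCLike.star_def, RCLike.conj_conj]
    ring
  rwa [← this]

end Multiplication

namespace FeldmanMoore

variable {X : Type*} [MeasurableSpace X] [StandardBorelSpace X] (F : FeldmanMoore X)

/-! ### Operators that commute with the left convolutions -/

lemma σ_right {x z : X} (h : (x, z) ∈ F.rel) : F.σ x z z = 1 :=
  F.normalised x z z h (F.rel_refl z) (Or.inr (Or.inl rfl))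

lemma σ_left {x z : X} (h : (x, z) ∈ F.rel) : F.σ x x z = 1 :=
  F.normalised x x z (F.rel_refl x) h (Or.inl rfl)

lemma σ_mul_σ_swap {x y z : X} (h : (x, y) ∈ F.rel) (h' : (y, z) ∈ F.rel) :
    F.σ x y z * F.σ x z y = 1 := by
  rw [F.cocycle x y z y h h' (F.rel_symm h'), F.σ_right h,
    F.normalised y z y h' (F.rel_symm h') (Or.inr (Or.inr rfl)), one_mul]

lemma IsDiagonal.isMultiplication {F : FeldmanMoore X} {α : X → ℂ} {T : F.Hil →L[ℂ] F.Hil}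
    (h : F.IsDiagonal α T) : IsMultiplication (fun p => α p.1) T := fun ξ => by
  filter_upwards [h.2.2 ξ, F.ae_mem_rel] with p hp hR
  rw [hp, tsum_eq_single p.1]
  · simp [diagFun, F.σ_left hR]
  · intro y hy
    simp [diagFun, hy.symm]

lemma IsDiagonal.mem_M₀ {F : FeldmanMoore X} {α : X → ℂ} {T : F.Hil →L[ℂ] F.Hil}
    (h : F.IsDiagonal α T) : T ∈ F.M₀ := by
  classical
  obtain ⟨hm, ⟨C, hC⟩, hT⟩ := h
  refine ⟨diagFun α, ⟨?_, ⟨C, fun p => ?_⟩, ?_, 2, fun x y => ?_⟩, hT⟩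
  · exact Measurable.ite measurableSet_diagonal (hm.comp measurable_fst) measurable_const
  · unfold diagFun
    split_ifs
    · exact hC _
    · rw [norm_zero]; exact (norm_nonneg _).trans (hC p.1)
  · rintro ⟨x, y⟩ hp
    by_cases h : x = y
    · subst h; exact F.rel_refl x
    · exact absurd (by simp [diagFun, h]) hp
  · have h1 : {z | diagFun α (z, y) ≠ 0} ⊆ {y} := fun z hz => by
      by_contra h
      exact hz (by simp only [diagFun]; exact if_neg h)
    have h2 : {z | diagFun α (x, z) ≠ 0} ⊆ {x} := fun z hz => by
      by_contra h
      exact hz (by simp only [diagFun]; exact if_neg fun h' => h h'.symm)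
    calc _ ≤ ({y} : Set X).encard + ({x} : Set X).encard :=
          add_le_add (Set.encard_le_encard h1) (Set.encard_le_encard h2)
      _ = 2 := by simp only [Set.encard_singleton]; norm_num

/-- `(S ξ)(x, z) = c(z) σ(x, f z, z) ξ(x, f z)`. -/
def IsRightShift (f : X → X) (c : X → ℂ) (S : F.Hil →L[ℂ] F.Hil) : Prop :=
  ∀ ξ : F.Hil, ∀ᵐ p ∂F.ν, S ξ p = c p.2 * (F.σ p.1 (f p.2) p.2 : ℂ) * ξ (p.1, f p.2)

lemma isRightShift_id {b : X → ℂ} {S : F.Hil →L[ℂ] F.Hil}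
    (h : IsMultiplication (fun p => b p.2) S) : F.IsRightShift id b S := fun ξ => by
  filter_upwards [h ξ, F.ae_mem_rel] with p hp hR
  rw [hp, id, F.σ_right hR]
  simp

variable {F} {f : X → X} {c : X → ℂ}

/-- One operator moves the left coordinate and the other the right; the twisting factors match by
the cocycle identity at `(x, y, f z, z)`. -/
lemma IsLeftConvolution.mul_eq_mul {a : X × X → ℂ} {S T : F.Hil →L[ℂ] F.Hil}
    (hT : F.IsLeftConvolution a T) (ha : Function.support a ⊆ F.rel)
    (hfr : ∀ z, (f z, z) ∈ F.rel) (hS : F.IsRightShift f c S) : T * S = S * T := by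
  refine ContinuousLinearMap.ext fun ξ => Lp.ext ?_
  simp only [mul_apply_eq_comp]
  filter_upwards [hT (S ξ), hS (T ξ), F.ae_mem_rel, F.ae_ν_snd (F.ae_ν_iff.1 (hS ξ)),
    F.ae_ν_snd (F.ae_forall_rel (F.ae_ν_iff.1 (hT ξ)))] with ⟨x, z⟩ h1 h2 hR h3 h4
  rw [h1, h2, h4 (f z) (hfr z) x (F.rel_trans hR (F.rel_symm (hfr z))), ← tsum_mul_left]
  refine tsum_congr fun y => ?_
  by_cases hy : a (x, y) = 0
  · simp [hy]
  have hxy : (x, y) ∈ F.rel := ha hy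
  have hyz : (y, z) ∈ F.rel := F.rel_trans (F.rel_symm hxy) hR
  have hco := congrArg (fun u : Circle => (u : ℂ))
    (F.cocycle x y (f z) z hxy (F.rel_trans hyz (F.rel_symm (hfr z))) (hfr z))
  simp only [Circle.coe_mul] at hco
  simp only [h3 y hyz]
  linear_combination (-(c z * a (x, y) * ξ (y, f z))) * hco

/-- Since `S` and its adjoint are both right shifts, `S` commutes with `M₀` and with its adjoints,
hence with the bicommutant. -/
lemma mul_eq_mul_of_mem_M {S T : F.Hil →L[ℂ] F.Hil} {f' : X → X} {c' : X → ℂ}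
    (hfr : ∀ z, (f z, z) ∈ F.rel) (hS : F.IsRightShift f c S) (hfr' : ∀ z, (f' z, z) ∈ F.rel)
    (hS' : F.IsRightShift f' c' (star S)) (hT : T ∈ F.M) : T * S = S * T := by
  have hmem : S ∈ StarSubalgebra.centralizer ℂ F.M₀ := by
    rw [StarSubalgebra.mem_centralizer_iff]
    rintro g ⟨a, ha, hg⟩
    refine ⟨hg.mul_eq_mul ha.2.2.1 hfr hS, ?_⟩
    have := congrArg star (hg.mul_eq_mul ha.2.2.1 hfr' hS')
    simpa only [star_mul, star_star] using this.symm
  have hT' : T ∈ StarSubalgebra.centralizer ℂ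
      (StarSubalgebra.centralizer ℂ F.M₀ : Set (F.Hil →L[ℂ] F.Hil)) := hT
  rw [StarSubalgebra.mem_centralizer_iff] at hT'
  exact ((hT' S hmem).1).symm

lemma mul_eq_mul_of_isMultiplication {b : X → ℂ} (hb : Measurable b) {C : ℝ}
    (hC : ∀ p, ‖b p‖ ≤ C) {S T : F.Hil →L[ℂ] F.Hil}
    (hS : IsMultiplication (fun p : X × X => b p.2) S) (hT : T ∈ F.M) : T * S = S * T :=
  mul_eq_mul_of_mem_M F.rel_refl (F.isRightShift_id hS) F.rel_refl
    (F.isRightShift_id (b := fun z => star (b z))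
      (hS.conj (hb.comp measurable_snd) fun p => hC p.2)) hT

lemma mem_M_of_mem_M₀ {T : F.Hil →L[ℂ] F.Hil} (hT : T ∈ F.M₀) : T ∈ F.M := by
  change T ∈ StarSubalgebra.centralizer ℂ
      (StarSubalgebra.centralizer ℂ F.M₀ : Set (F.Hil →L[ℂ] F.Hil))
  rw [StarSubalgebra.mem_centralizer_iff]
  intro g hg
  have hg1 := (StarSubalgebra.mem_centralizer_iff ℂ).1 hg T hT
  refine ⟨hg1.1.symm, ?_⟩
  have := congrArg star hg1.2
  simpa only [star_mul, star_star] using this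

end FeldmanMoore

/-! ### Right shifts along partial isomorphisms, and their adjoints. -/

namespace FeldmanMoore

variable {X : Type*} [MeasurableSpace X] [StandardBorelSpace X] (F : FeldmanMoore X)
  {f g : X → X} {c : X → ℂ}

lemma eLpNorm_two_eq {Z : Type*} [MeasurableSpace Z] (m : Measure Z) (h : Z → ℂ) :
    eLpNorm h 2 m = (∫⁻ p, ‖h p‖ₑ ^ 2 ∂m) ^ (1 / 2 : ℝ) := by
  rw [eLpNorm_eq_lintegral_rpow_enorm_toReal (by norm_num) (by norm_num)]
  simp

lemma exists_isRightShift (hf : Measurable f) (hfr : ∀ z, (f z, z) ∈ F.rel) (hc : Measurable c)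
    (K : ℝ) (hK : ∀ h : X × X → ℝ≥0∞, Measurable h →
      ∫⁻ p, ‖c p.2‖ₑ ^ 2 * h (p.1, f p.2) ∂F.ν ≤ ENNReal.ofReal K * ∫⁻ p, h p ∂F.ν) :
    ∃ S, F.IsRightShift f c S := by
  have hΦ : Measurable fun p : X × X => (p.1, f p.2) :=
    measurable_fst.prodMk (hf.comp measurable_snd)
  have hσ : Measurable fun p : X × X => (F.σ p.1 (f p.2) p.2 : ℂ) :=
    F.measurable_σ.comp (measurable_fst.prodMk ((hf.comp measurable_snd).prodMk measurable_snd))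
  let A : (X × X → ℂ) → X × X → ℂ := fun ξ p =>
    c p.2 * (F.σ p.1 (f p.2) p.2 : ℂ) * ξ (p.1, f p.2)
  have hA : ∀ ξ : F.Hil, Measurable (A ξ) := fun ξ =>
    ((hc.comp measurable_snd).mul hσ).mul ((Lp.stronglyMeasurable ξ).measurable.comp hΦ)
  have hle : ∀ ξ : F.Hil, eLpNorm (A ξ) 2 F.ν ≤
      ENNReal.ofReal K ^ (1 / 2 : ℝ) * eLpNorm ξ 2 F.ν := by
    intro ξ
    rw [eLpNorm_two_eq, eLpNorm_two_eq, ← ENNReal.mul_rpow_of_nonneg _ _ (by norm_num)]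
    refine ENNReal.rpow_le_rpow ?_ (by norm_num)
    refine le_trans (le_of_eq (lintegral_congr fun p => ?_))
      (hK (fun p => ‖ξ p‖ₑ ^ 2) ((Lp.stronglyMeasurable ξ).measurable.enorm.pow_const 2))
    simp only [A, enorm_mul, mul_pow]
    have : ‖(F.σ p.1 (f p.2) p.2 : ℂ)‖ₑ = 1 := by
      rw [← ofReal_norm, Circle.norm_coe, ENNReal.ofReal_one]
    rw [this, one_pow, mul_one]
  have hmem : ∀ ξ : F.Hil, MemLp (A ξ) 2 F.ν := fun ξ =>
    ⟨(hA ξ).aestronglyMeasurable, (hle ξ).trans_lt (ENNReal.mul_lt_top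
      (ENNReal.rpow_lt_top_of_nonneg (by norm_num) ENNReal.ofReal_ne_top) (Lp.eLpNorm_lt_top ξ))⟩
  -- Quasi-invariance makes the substitution `z ↦ f z` respect null sets, so the formula is well
  -- defined on classes.
  have hae : ∀ {ξ η : X × X → ℂ}, ξ =ᵐ[F.ν] η →
      ∀ᵐ p ∂F.ν, ξ (p.1, f p.2) = η (p.1, f p.2) := by
    intro ξ η h
    filter_upwards [F.ae_mem_rel, F.ae_ν_snd (F.ae_forall_rel (F.ae_ν_iff.1 h))] with p hR hp
    exact hp (f p.2) (hfr _) p.1 (F.rel_trans hR (F.rel_symm (hfr _)))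
  refine ⟨LinearMap.mkContinuous
    { toFun := fun ξ => (hmem ξ).toLp
      map_add' := fun ξ η => ?_
      map_smul' := fun r ξ => ?_ } (ENNReal.ofReal K ^ (1 / 2 : ℝ)).toReal fun ξ => ?_, fun ξ => ?_⟩
  · refine Lp.ext ?_
    filter_upwards [(hmem (ξ + η)).coeFn_toLp, (hmem ξ).coeFn_toLp, (hmem η).coeFn_toLp,
      Lp.coeFn_add (hmem ξ).toLp (hmem η).toLp, hae (Lp.coeFn_add ξ η)] with p h1 h2 h3 h4 h5
    rw [h1, h4, Pi.add_apply, h2, h3]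
    simp only [A, h5, Pi.add_apply, mul_add]
  · refine Lp.ext ?_
    filter_upwards [(hmem (r • ξ)).coeFn_toLp, (hmem ξ).coeFn_toLp,
      Lp.coeFn_smul r (hmem ξ).toLp, hae (Lp.coeFn_smul r ξ)] with p h1 h2 h4 h5
    rw [h1, RingHom.id_apply, h4, Pi.smul_apply, h2]
    simp only [A, h5, Pi.smul_apply, smul_eq_mul]
    ring
  · change ‖(hmem ξ).toLp‖ ≤ _
    rw [Lp.norm_toLp, Lp.norm_def, ← ENNReal.toReal_mul]
    exact ENNReal.toReal_mono (ENNReal.mul_ne_top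
      (ENNReal.rpow_lt_top_of_nonneg (by norm_num) ENNReal.ofReal_ne_top).ne
      (Lp.eLpNorm_lt_top ξ).ne) (hle ξ)
  · exact (hmem ξ).coeFn_toLp

lemma map_restrict_eq_withDensity (hf : Measurable f) (hfr : ∀ z, (f z, z) ∈ F.rel) {d : Set X}
    (hd : MeasurableSet d) :
    (F.ν.restrict (Prod.snd ⁻¹' d)).map (fun p => (p.1, f p.2)) =
      F.ν.withDensity fun p => F.density f d p.2 := by
  have hΦ : Measurable fun p : X × X => (p.1, f p.2) :=
    measurable_fst.prodMk (hf.comp measurable_snd)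
  ext E hE
  rw [Measure.map_apply hΦ hE, Measure.restrict_apply (hΦ hE), withDensity_apply _ hE,
    ← lintegral_indicator_one ((hΦ hE).inter (measurable_snd hd)), ← lintegral_indicator hE]
  have := F.lintegral_comp_right hf hfr hd (h := E.indicator 1) (measurable_one.indicator hE)
  convert this using 3 with p p
  · by_cases h1 : p.2 ∈ d <;> by_cases h2 : (p.1, f p.2) ∈ E <;> simp [h1, h2, Set.indicator]
  · by_cases h2 : p ∈ E <;> simp [h2]

open Classical in
lemma integral_comp_right (hf : Measurable f) (hfr : ∀ z, (f z, z) ∈ F.rel) {d : Set X}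
    (hd : MeasurableSet d) {h : X × X → ℂ} (hh : Measurable h) :
    ∫ p, (if p.2 ∈ d then h (p.1, f p.2) else 0) ∂F.ν =
      ∫ p, ((F.density f d p.2).toReal : ℂ) * h p ∂F.ν := by
  have hΦ : Measurable fun p : X × X => (p.1, f p.2) :=
    measurable_fst.prodMk (hf.comp measurable_snd)
  calc _ = ∫ p in Prod.snd ⁻¹' d, h (p.1, f p.2) ∂F.ν := by
        rw [← integral_indicator (measurable_snd hd)]
        rfl
    _ = ∫ p, h p ∂(F.ν.restrict (Prod.snd ⁻¹' d)).map (fun p => (p.1, f p.2)) :=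
        (integral_map hΦ.aemeasurable hh.aestronglyMeasurable).symm
    _ = _ := by
        rw [F.map_restrict_eq_withDensity hf hfr hd, integral_withDensity_eq_integral_toReal_smul
          (f := fun p : X × X => F.density f d p.2) ((F.measurable_density f d).comp measurable_snd)
          (F.ae_ν_snd (F.density_lt_top f d))]
        refine integral_congr_ae (ae_of_all _ fun p => ?_)
        simp

/-- The points at which `f` is inverted by `g`. -/
def inverseSet (f g : X → X) : Set X := {z | g (f z) = z}

lemma measurableSet_inverseSet (hf : Measurable f) (hg : Measurable g) :
    MeasurableSet (inverseSet f g) := by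
  let := upgradeStandardBorel X
  exact measurableSet_eq_fun (hg.comp hf) measurable_id

/-- The part of the range of `f` over which the inverse is `g` and the density is at most `K`. -/
def boundedRange (f g : X → X) (K : ℕ) : Set X :=
  {w | F.density f (inverseSet f g) w ≤ K ∧ f (g w) = w}

lemma measurableSet_boundedRange (hf : Measurable f) (hg : Measurable g) (K : ℕ) :
    MeasurableSet (F.boundedRange f g K) := by
  let := upgradeStandardBorel X
  exact (measurableSet_le (F.measurable_density _ _) measurable_const).inter
    (measurableSet_eq_fun (hf.comp hg) measurable_id)

/-- The domain of the partial isomorphism `f` with inverse `g`, with density at most `K`. -/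
def boundedDomain (f g : X → X) (K : ℕ) : Set X :=
  inverseSet f g ∩ f ⁻¹' F.boundedRange f g K

lemma measurableSet_boundedDomain (hf : Measurable f) (hg : Measurable g) (K : ℕ) :
    MeasurableSet (F.boundedDomain f g K) :=
  (measurableSet_inverseSet hf hg).inter (hf (F.measurableSet_boundedRange hf hg K))

-- The adjoint of the shift along `f` is the shift along the inverse `g`, weighted by the density.
-- Cutting off where the density exceeds `K` makes both operators bounded.
open Classical in
lemma exists_isRightShift_star (hf : Measurable f) (hfr : ∀ z, (f z, z) ∈ F.rel)
    (hg : Measurable g) (hgr : ∀ z, (g z, z) ∈ F.rel) (K : ℕ) :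
    ∃ S, F.IsRightShift f (fun z => if z ∈ F.boundedDomain f g K then 1 else 0) S ∧
      F.IsRightShift g (fun w => if w ∈ F.boundedRange f g K then
        ((F.density f (inverseSet f g) w).toReal : ℂ) else 0) (star S) := by
  set d := inverseSet f g with hd_def
  set D := F.density f d with hD_def
  set V := F.boundedRange f g K with hV_def
  have hd : MeasurableSet d := measurableSet_inverseSet hf hg
  have hV : MeasurableSet V := F.measurableSet_boundedRange hf hg K
  have hDm : Measurable D := F.measurable_density f d
  have hVd : ∀ z, z ∈ F.boundedDomain f g K ↔ z ∈ d ∧ f z ∈ V := fun z => Iff.rfl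
  obtain ⟨S, hS⟩ := F.exists_isRightShift hf hfr
    (c := fun z => if z ∈ F.boundedDomain f g K then 1 else 0)
    (Measurable.ite (F.measurableSet_boundedDomain hf hg K) measurable_const measurable_const) K
    fun h hh => by
      have := F.lintegral_comp_right hf hfr hd
        (h := fun p => V.indicator 1 p.2 * h p)
        (((measurable_one.indicator hV).comp measurable_snd).mul hh)
      calc _ = _ := lintegral_congr fun p => by
            by_cases h1 : p.2 ∈ d <;> by_cases h2 : f p.2 ∈ V <;> simp [hVd, h1, h2]
        _ = _ := this
        _ ≤ ∫⁻ p, K * h p ∂F.ν := lintegral_mono fun p => by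
            by_cases h2 : p.2 ∈ V
            · simp only [h2, Set.indicator_of_mem, Pi.one_apply, one_mul]
              gcongr
              exact h2.1
            · simp [h2]
        _ = _ := by rw [lintegral_const_mul _ hh]; simp
  have hcm : Measurable fun w => if w ∈ V then ((D w).toReal : ℂ) else 0 :=
    Measurable.ite hV (Complex.measurable_ofReal.comp hDm.ennreal_toReal) measurable_const
  -- Of the squared density, one factor is absorbed by changing variables back along `f`, and the
  -- other is at most `K`.
  obtain ⟨S', hS'⟩ := F.exists_isRightShift hg hgr hcm K fun h hh => by
      have hΨ : Measurable fun p : X × X => (p.1, g p.2) :=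
        measurable_fst.prodMk (hg.comp measurable_snd)
      have := F.lintegral_comp_right hf hfr hd
        (h := fun p => V.indicator 1 p.2 * D p.2 * h (p.1, g p.2))
        ((((measurable_one.indicator hV).mul hDm).comp measurable_snd).mul (hh.comp hΨ))
      calc _ = ∫⁻ p, D p.2 * (V.indicator 1 p.2 * D p.2 * h (p.1, g p.2)) ∂F.ν :=
            lintegral_congr fun p => by
              by_cases h2 : p.2 ∈ V
              · have hfin : D p.2 ≠ ∞ := ne_top_of_le_ne_top (ENNReal.natCast_ne_top K) h2.1
                have : ‖((D p.2).toReal : ℂ)‖ₑ = D p.2 := by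
                  rw [← ofReal_norm, Complex.norm_real, Real.norm_of_nonneg ENNReal.toReal_nonneg,
                    ENNReal.ofReal_toReal hfin]
                simp only [h2, if_true, this, Set.indicator_of_mem, Pi.one_apply, one_mul]
                ring
              · simp [h2]
        _ = _ := this.symm
        _ ≤ ∫⁻ p, K * h p ∂F.ν := lintegral_mono fun p => by
            by_cases h1 : p.2 ∈ d
            · have hgf : g (f p.2) = p.2 := h1
              by_cases h2 : f p.2 ∈ V
              · simp only [h1, h2, Set.indicator_of_mem, Pi.one_apply, one_mul, hgf]
                gcongr
                exact h2.1
              · simp [h2]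
            · simp [h1]
        _ = _ := by rw [lintegral_const_mul _ hh]; simp
  refine ⟨S, hS, ?_⟩
  have hadj : star S = S' := by
    rw [ContinuousLinearMap.star_eq_adjoint, eq_comm, ContinuousLinearMap.eq_adjoint_iff]
    intro η ξ
    rw [L2.inner_def, L2.inner_def]
    have hΨ : Measurable fun p : X × X => (p.1, g p.2) :=
      measurable_fst.prodMk (hg.comp measurable_snd)
    have hσ : Measurable fun p : X × X => (F.σ p.1 p.2 (g p.2) : ℂ) :=
      F.measurable_σ.comp (measurable_fst.prodMk (measurable_snd.prodMk (hg.comp measurable_snd)))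
    let G : X × X → ℂ := fun p => if p.2 ∈ V then
      (F.σ p.1 p.2 (g p.2) : ℂ) * ξ p * star (η (p.1, g p.2)) else 0
    have hG : Measurable G := Measurable.ite (measurable_snd hV)
      ((hσ.mul (Lp.stronglyMeasurable ξ).measurable).mul
        (continuous_star.measurable.comp ((Lp.stronglyMeasurable η).measurable.comp hΨ)))
      measurable_const
    have key := F.integral_comp_right hf hfr hd hG
    calc _ = ∫ p, ((D p.2).toReal : ℂ) * G p ∂F.ν := by
          refine integral_congr_ae ?_
          filter_upwards [hS' η, F.ae_mem_rel] with p hp hR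
          rw [hp]
          by_cases h2 : p.2 ∈ V
          · have hs := congrArg (fun u : Circle => (u : ℂ)) (F.σ_mul_σ_swap
              (F.rel_trans hR (F.rel_symm (hgr p.2))) (hgr p.2))
            simp only [Circle.coe_mul, Circle.coe_one] at hs
            -- Normalisation gives `σ(x, y, z) σ(x, z, y) = 1`, so conjugating the twist swaps its
            -- last two arguments.
            have hconj : star (F.σ p.1 (g p.2) p.2 : ℂ) = (F.σ p.1 p.2 (g p.2) : ℂ) := by
              have h1 : (F.σ p.1 (g p.2) p.2 : ℂ) * star (F.σ p.1 (g p.2) p.2 : ℂ) = 1 := by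
                rw [RCLike.star_def, Complex.mul_conj, Circle.normSq_coe, Complex.ofReal_one]
              exact mul_left_cancel₀ (Circle.coe_ne_zero _) (h1.trans hs.symm)
            simp only [G, h2, if_true, RCLike.inner_apply, map_mul, ← hconj, RCLike.star_def,
              Complex.conj_ofReal]
            ring
          · simp [G, h2]
      _ = _ := key.symm
      _ = _ := by
          refine integral_congr_ae ?_
          filter_upwards [hS ξ] with p hp
          rw [hp]
          by_cases h1 : p.2 ∈ d
          · have hgf : g (f p.2) = p.2 := h1
            by_cases h2 : f p.2 ∈ V
            · simp only [G, h1, h2, hVd, hgf, if_true, RCLike.inner_apply, RCLike.star_def, true_and]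
              ring
            · simp [G, h2, hVd]
          · simp [h1, hVd]
  rw [hadj]
  exact hS'

end FeldmanMoore

/-! ### The diagonal vector is separating for the von Neumann algebra. -/

namespace FeldmanMoore

variable {X : Type*} [MeasurableSpace X] [StandardBorelSpace X] {F : FeldmanMoore X}
  {f g : X → X} {c : X → ℂ}

lemma χΔ_ae : ∀ᵐ p ∂F.ν, (p.1 = p.2 → F.χΔ p = 1) ∧ (p.1 ≠ p.2 → F.χΔ p = 0) := by
  filter_upwards [indicatorConstLp_coeFn (p := 2) (hs := measurableSet_diagonal)
    (hμs := F.ν_diagonal_ne_top) (c := (1 : ℂ))] with p hp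
  constructor
  · intro h
    exact hp.trans (Set.indicator_of_mem (show p ∈ Set.diagonal X from h) _)
  · intro h
    exact hp.trans (Set.indicator_of_notMem (show p ∉ Set.diagonal X from h) _)

/-- `T ∈ M` annihilates the indicator functions of subsets of graphs if `T χ_Δ = 0`. -/
lemma apply_indicator_eq_zero {T : F.Hil →L[ℂ] F.Hil} (hT : T ∈ F.M) (h0 : T F.χΔ = 0)
    (hf : Measurable f) (hfr : ∀ z, (f z, z) ∈ F.rel)
    (hg : Measurable g) (hgr : ∀ z, (g z, z) ∈ F.rel) (K : ℕ) {E : Set (X × X)}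
    (hE : MeasurableSet E) (hEs : E ⊆ graph f ∩ Prod.snd ⁻¹' F.boundedDomain f g K)
    (hEν : F.ν E ≠ ∞) : T (indicatorConstLp 2 hE hEν (1 : ℂ)) = 0 := by
  classical
  obtain ⟨S, hS, hS'⟩ := F.exists_isRightShift_star hf hfr hg hgr K
  set Z : Set X := {z | (f z, z) ∈ E}
  have hZ : MeasurableSet Z := (hf.prodMk measurable_id) hE
  have hb : Measurable fun z => if z ∈ Z then (1 : ℂ) else 0 :=
    Measurable.ite hZ measurable_const measurable_const
  have hC : ∀ z, ‖if z ∈ Z then (1 : ℂ) else 0‖ ≤ 1 := fun z => by split_ifs <;> simp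
  obtain ⟨R, hR⟩ := exists_isMultiplication (m := F.ν) (hb.comp measurable_snd) fun p => hC p.2
  -- `S χ_Δ` is the indicator of the graph of `f` over the bounded domain (the twist is 1 there),
  -- and `R` cuts it down to `E`.
  have heq : indicatorConstLp 2 hE hEν (1 : ℂ) = R (S F.χΔ) := by
    refine Lp.ext ?_
    filter_upwards [indicatorConstLp_coeFn (p := 2) (hs := hE) (hμs := hEν) (c := (1 : ℂ)),
      hR (S F.χΔ), hS F.χΔ, F.ae_mem_rel,
      F.ae_ν_snd (F.ae_forall_rel (F.ae_ν_iff.1 (F.χΔ_ae)))] with ⟨x, z⟩ h1 h2 h3 hR h4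
    have h5 := h4 (f z) (hfr z) x (F.rel_trans hR (F.rel_symm (hfr z)))
    rw [h1, h2, h3]
    simp only [Function.comp]
    by_cases hp : (x, z) ∈ E
    · obtain ⟨hx, hz⟩ := hEs hp
      obtain rfl : x = f z := hx
      have hzZ : z ∈ Z := hp
      have hzd : z ∈ F.boundedDomain f g K := hz
      rw [Set.indicator_of_mem hp, h5.1 rfl, if_pos hzZ, if_pos hzd, F.σ_left (hfr z)]
      simp
    · rw [Set.indicator_of_notMem hp]
      by_cases hx : x = f z
      · have hzZ : z ∉ Z := fun h => hp (hx ▸ h)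
        rw [if_neg hzZ, zero_mul]
      · rw [h5.2 hx]
        simp
  have e1 : T * R = R * T := mul_eq_mul_of_isMultiplication hb hC hR hT
  have e2 : T * S = S * T := mul_eq_mul_of_mem_M hfr hS hgr hS' hT
  calc T _ = (T * R) (S F.χΔ) := by rw [heq]; rfl
    _ = R ((T * S) F.χΔ) := by rw [e1]; rfl
    _ = R (S (T F.χΔ)) := by rw [e2]; rfl
    _ = 0 := by rw [h0, map_zero, map_zero]

/-- `χ_Δ` is a separating vector for `M`. -/
lemma eq_zero_of_apply_χΔ {T : F.Hil →L[ℂ] F.Hil} (hT : T ∈ F.M) (h0 : T F.χΔ = 0) : T = 0 := by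
  have hprob := F.isProbabilityMeasure
  obtain ⟨f, hfm, hfr, hfc⟩ := F.exists_graph_cover
  -- `T` kills indicators of subsets of graph pieces, so each `T* η` integrates to zero over all of
  -- them and vanishes on every piece.
  suffices h : star T = 0 by simpa using congrArg star h
  refine ContinuousLinearMap.ext fun η => Lp.ext ?_
  set ζ := star T η with hζ
  have hpiece : ∀ q : ℕ × ℕ × ℕ, ∀ᵐ p ∂F.ν, p ∈ graph (f q.1) ∩
      Prod.snd ⁻¹' F.boundedDomain (f q.1) (f q.2.1) q.2.2 → ζ p = 0 := by
    rintro ⟨n, k, K⟩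
    set E := graph (f n) ∩ Prod.snd ⁻¹' F.boundedDomain (f n) (f k) K with hE_def
    have hE : MeasurableSet E := (measurableSet_graph (hfm n)).inter
      (measurable_snd (F.measurableSet_boundedDomain (hfm n) (hfm k) K))
    have hfin : IsFiniteMeasure (F.ν.restrict E) := by
      have : IsFiniteMeasure (F.ν.restrict (graph (f n))) := by
        rw [F.restrict_graph (hfm n) (hfr n)]
        infer_instance
      exact isFiniteMeasure_of_le _ (Measure.restrict_mono Set.inter_subset_left le_rfl)
    rw [← ae_restrict_iff' hE]
    have hint : Integrable ζ (F.ν.restrict E) :=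
      ((Lp.memLp ζ).restrict E).integrable (by norm_num)
    refine hint.ae_eq_zero_of_forall_setIntegral_eq_zero fun s hs _ => ?_
    rw [Measure.restrict_restrict hs]
    have hsE : F.ν (s ∩ E) ≠ ∞ := by
      have := measure_ne_top (F.ν.restrict E) s
      rwa [Measure.restrict_apply hs] at this
    rw [← L2.inner_indicatorConstLp_one (𝕜 := ℂ) (hs.inter hE) hsE ζ, hζ,
      ContinuousLinearMap.star_eq_adjoint, ContinuousLinearMap.adjoint_inner_right,
      apply_indicator_eq_zero hT h0 (hfm n) (hfr n) (hfm k) (hfr k) K (hs.inter hE)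
        Set.inter_subset_right hsE, inner_zero_left]
  have hcover : ∀ᵐ p ∂F.ν, ∃ q : ℕ × ℕ × ℕ, p ∈ graph (f q.1) ∩
      Prod.snd ⁻¹' F.boundedDomain (f q.1) (f q.2.1) q.2.2 := by
    refine F.ae_ν_iff.2 ?_
    have hdens : ∀ᵐ z ∂F.μ, ∀ n k, F.density (f n) (inverseSet (f n) (f k)) z < ∞ :=
      ae_all_iff.2 fun n => ae_all_iff.2 fun k => F.density_lt_top _ _
    -- For `x = f n z`, the cover over `x` supplies `k` with `f k x = z`, and `K` is chosen above
    -- the finite density at `x`.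
    filter_upwards [hfc, F.ae_forall_rel hfc, F.ae_forall_rel hdens] with z h1 h2 h3 x hx
    obtain ⟨n, rfl⟩ := h1 x hx
    obtain ⟨k, hk⟩ := h2 _ hx z (F.rel_symm hx)
    obtain ⟨K, hK⟩ := ENNReal.exists_nat_gt (h3 _ hx n k).ne
    exact ⟨(n, k, K), rfl, hk, hK.le, congrArg (f n) hk⟩
  filter_upwards [ae_all_iff.2 hpiece, hcover,
    Lp.coeFn_zero ℂ 2 F.ν] with p h1 ⟨q, hq⟩ h3
  rw [h1 q hq]
  exact h3.symm

lemma symbol_injOn : Set.InjOn F.symbol (F.M : Set (F.Hil →L[ℂ] F.Hil)) := by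
  intro T hT T' hT' h
  rw [← sub_eq_zero]
  refine eq_zero_of_apply_χΔ (sub_mem (S := StarSubalgebra ℂ _) hT hT') ?_
  rw [sub_apply]
  exact sub_eq_zero.2 h

lemma invSymbol_symbol {T : F.Hil →L[ℂ] F.Hil} (hT : T ∈ F.M) : F.invSymbol (F.symbol T) = T :=
  symbol_injOn.leftInvOn_invFunOn hT

end FeldmanMoore

/-! ### Functions `∑ᵢ aᵢ(x) bᵢ(y)` determined by integrals over rectangles. -/

section SquareSummable

variable {Z : Type*} [MeasurableSpace Z] {m : Measure Z}

lemma aestronglyMeasurable_tsum {𝕜 : Type*} [NormedAddCommGroup 𝕜] {f : ℕ → Z → 𝕜}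
    (hf : ∀ i, AEStronglyMeasurable (f i) m) (hs : ∀ᵐ z ∂m, Summable fun i => f i z) :
    AEStronglyMeasurable (fun z => ∑' i, f i z) m := by
  refine aestronglyMeasurable_of_tendsto_ae atTop
    (f := fun n z => ∑ i ∈ Finset.range n, f i z) (fun n => ?_) ?_
  · exact Finset.aestronglyMeasurable_fun_sum _ fun i _ => hf i
  · filter_upwards [hs] with z hz
    exact hz.hasSum.tendsto_sum_nat

lemma hasSum_integral_tsum {f : ℕ → Z → ℂ} (hf : ∀ i, AEStronglyMeasurable (f i) m) {g : Z → ℝ}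
    (hg : Integrable g m) (hfg : ∀ᵐ z ∂m, ∀ s : Finset ℕ, ∑ i ∈ s, ‖f i z‖ ≤ g z) :
    HasSum (fun i => ∫ z, f i z ∂m) (∫ z, ∑' i, f i z ∂m) := by
  have hs : ∀ᵐ z ∂m, Summable fun i => ‖f i z‖ := hfg.mono fun z hz =>
    summable_of_sum_le (fun _ => norm_nonneg _) hz
  refine hasSum_integral_of_dominated_convergence (fun i z => ‖f i z‖) hf
    (fun i => ae_of_all _ fun z => le_rfl) hs ?_ (hs.mono fun z hz => hz.of_norm.hasSum)
  refine hg.mono' (aestronglyMeasurable_tsum (fun i => (hf i).norm) hs) ?_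
  filter_upwards [hfg, hs] with z hz hsz
  rw [Real.norm_of_nonneg (tsum_nonneg fun _ => norm_nonneg _)]
  exact hsz.tsum_le_of_sum_le hz

lemma sum_norm_mul_le_of_sq_le {a b : ℕ → ℂ} {C D : ℝ}
    (ha : ∀ s : Finset ℕ, ∑ i ∈ s, ‖a i‖ ^ 2 ≤ C) (hb : ∀ s : Finset ℕ, ∑ i ∈ s, ‖b i‖ ^ 2 ≤ D)
    (s : Finset ℕ) : ∑ i ∈ s, ‖a i * b i‖ ≤ √C * √D := by
  simp only [norm_mul]
  exact (Real.sum_mul_le_sqrt_mul_sqrt s _ _).trans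
    (mul_le_mul (Real.sqrt_le_sqrt (ha s)) (Real.sqrt_le_sqrt (hb s)) (Real.sqrt_nonneg _)
      (Real.sqrt_nonneg _))

lemma memℓp_two_of_sum_le {a : ℕ → ℂ} {C : ℝ} (ha : ∀ s : Finset ℕ, ∑ i ∈ s, ‖a i‖ ^ 2 ≤ C) :
    Memℓp a 2 := memℓp_gen' (C := C) fun s => by simpa using ha s

lemma sum_sq_le_of_memℓp {a : ℕ → ℂ} (ha : Memℓp a 2) :
    ∃ C, ∀ s : Finset ℕ, ∑ i ∈ s, ‖a i‖ ^ 2 ≤ C := by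
  have : Summable fun i => ‖a i‖ ^ 2 := by simpa using ha.summable (by norm_num)
  exact ⟨_, fun s => this.sum_le_tsum s fun _ _ => sq_nonneg _⟩

/-- The bilinear pairing `∑ᵢ aᵢ bᵢ` on `ℓ²`. -/
noncomputable def ellTwoPairing (x y : lp (fun _ : ℕ => ℂ) 2) : ℂ := inner ℂ (star x) y

lemma ellTwoPairing_eq_tsum (x y : lp (fun _ : ℕ => ℂ) 2) :
    ellTwoPairing x y = ∑' i, x i * y i := by
  rw [ellTwoPairing, lp.inner_eq_tsum]
  refine tsum_congr fun i => ?_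
  rw [lp.star_apply, RCLike.inner_apply, RCLike.star_def, RCLike.conj_conj, mul_comm]

lemma continuous_ellTwoPairing_left (y : lp (fun _ : ℕ => ℂ) 2) :
    Continuous fun x => ellTwoPairing x y :=
  continuous_star.inner continuous_const

lemma continuous_ellTwoPairing_right (x : lp (fun _ : ℕ => ℂ) 2) :
    Continuous fun y => ellTwoPairing x y :=
  continuous_const.inner continuous_id

lemma separableSpace_ellTwo : TopologicalSpace.SeparableSpace (lp (fun _ : ℕ => ℂ) 2) := by
  let b : HilbertBasis ℕ ℂ (lp (fun _ : ℕ => ℂ) 2) :=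
    HilbertBasis.ofRepr (LinearIsometryEquiv.refl ℂ _)
  have h : TopologicalSpace.IsSeparable (Set.univ : Set (lp (fun _ : ℕ => ℂ) 2)) := by
    have h1 := ((Set.countable_range b).isSeparable.span (R := ℂ)).closure
    have h2 := congrArg (fun S : Submodule ℂ (lp (fun _ : ℕ => ℂ) 2) => (S : Set (lp (fun _ : ℕ => ℂ) 2)))
      b.dense_span
    simp only [Submodule.topologicalClosure_coe, Submodule.top_coe] at h2
    rwa [h2] at h1
  exact TopologicalSpace.isSeparable_univ_iff.1 h

/-- In a separable space, every family has a countable subfamily which is dense in its range. -/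
lemma exists_countable_dense_subfamily {ι E : Type*} [PseudoMetricSpace E]
    [TopologicalSpace.SeparableSpace E] (v : ι → E) :
    ∃ D : Set ι, D.Countable ∧ Set.range v ⊆ closure (v '' D) := by
  have : SecondCountableTopology E := UniformSpace.secondCountable_of_separable E
  obtain ⟨c, hcP, hc, hcl⟩ := TopologicalSpace.IsSeparable.exists_countable_dense_subset
    (TopologicalSpace.IsSeparable.of_separableSpace (Set.range v))
  choose r hr using fun e : c => hcP e.2
  have := hc.to_subtype
  refine ⟨Set.range r, Set.countable_range r, ?_⟩
  rwa [← Set.range_comp, show v ∘ r = Subtype.val from funext hr, Subtype.range_coe]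

variable [IsFiniteMeasure m] {a b a' b' : ℕ → Z → ℂ} {C : ℝ}

lemma hasSum_setIntegral_mul (ha : ∀ i, Measurable (a i))
    (haC : ∀ᵐ z ∂m, ∀ s : Finset ℕ, ∑ i ∈ s, ‖a i z‖ ^ 2 ≤ C) {β : ℕ → ℂ} (hβ : Memℓp β 2)
    (S : Set Z) : HasSum (fun i => (∫ z in S, a i z ∂m) * β i)
      (∫ z in S, ∑' i, a i z * β i ∂m) := by
  obtain ⟨D, hD⟩ := sum_sq_le_of_memℓp hβ
  have := hasSum_integral_tsum (m := m.restrict S) (f := fun i z => a i z * β i)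
    (fun i => ((ha i).mul_const _).aestronglyMeasurable) (integrable_const (√C * √D))
    (ae_restrict_of_ae (haC.mono fun z hz => sum_norm_mul_le_of_sq_le hz hD))
  simpa only [integral_mul_const] using this

lemma integrable_tsum_mul (ha : ∀ i, Measurable (a i))
    (haC : ∀ᵐ z ∂m, ∀ s : Finset ℕ, ∑ i ∈ s, ‖a i z‖ ^ 2 ≤ C) {β : ℕ → ℂ} (hβ : Memℓp β 2) :
    Integrable (fun z => ∑' i, a i z * β i) m := by
  obtain ⟨D, hD⟩ := sum_sq_le_of_memℓp hβ
  have hs : ∀ᵐ z ∂m, Summable fun i => ‖a i z * β i‖ := haC.mono fun z hz =>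
    summable_of_sum_le (fun _ => norm_nonneg _) (sum_norm_mul_le_of_sq_le hz hD)
  refine (integrable_const (√C * √D)).mono' (aestronglyMeasurable_tsum
    (fun i => ((ha i).mul_const _).aestronglyMeasurable) (hs.mono fun z hz => hz.of_norm)) ?_
  filter_upwards [haC, hs] with z hz hsz
  exact (norm_tsum_le_tsum_norm hsz).trans
    (hsz.tsum_le_of_sum_le (sum_norm_mul_le_of_sq_le hz hD))

lemma ae_tsum_mul_eq (ha : ∀ i, Measurable (a i)) (ha' : ∀ i, Measurable (a' i))
    (haC : ∀ᵐ z ∂m, ∀ s : Finset ℕ, ∑ i ∈ s, ‖a i z‖ ^ 2 ≤ C)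
    (haC' : ∀ᵐ z ∂m, ∀ s : Finset ℕ, ∑ i ∈ s, ‖a' i z‖ ^ 2 ≤ C) {β β' : ℕ → ℂ}
    (hβ : Memℓp β 2) (hβ' : Memℓp β' 2)
    (h : ∀ S, MeasurableSet S → ∑' i, (∫ z in S, a i z ∂m) * β i =
      ∑' i, (∫ z in S, a' i z ∂m) * β' i) :
    ∀ᵐ z ∂m, ∑' i, a i z * β i = ∑' i, a' i z * β' i := by
  refine Integrable.ae_eq_of_forall_setIntegral_eq _ _ (integrable_tsum_mul ha haC hβ)
    (integrable_tsum_mul ha' haC' hβ') fun S hS _ => ?_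
  rw [← (hasSum_setIntegral_mul ha haC hβ S).tsum_eq,
    ← (hasSum_setIntegral_mul ha' haC' hβ' S).tsum_eq]
  exact h S hS

/-- If two functions `∑ᵢ aᵢ(x) bᵢ(y)` have the same integrals over rectangles, then they agree
marginally almost everywhere. -/
theorem exists_forall_tsum_mul_eq (ha : ∀ i, Measurable (a i)) (ha' : ∀ i, Measurable (a' i))
    (hb : ∀ i, Measurable (b i)) (hb' : ∀ i, Measurable (b' i))
    (haC : ∀ᵐ z ∂m, ∀ s : Finset ℕ, ∑ i ∈ s, ‖a i z‖ ^ 2 ≤ C)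
    (haC' : ∀ᵐ z ∂m, ∀ s : Finset ℕ, ∑ i ∈ s, ‖a' i z‖ ^ 2 ≤ C)
    (hbC : ∀ᵐ z ∂m, ∀ s : Finset ℕ, ∑ i ∈ s, ‖b i z‖ ^ 2 ≤ C)
    (hbC' : ∀ᵐ z ∂m, ∀ s : Finset ℕ, ∑ i ∈ s, ‖b' i z‖ ^ 2 ≤ C)
    (hβ : ∀ S, MeasurableSet S → Memℓp (fun i => ∫ z in S, b i z ∂m) 2)
    (hβ' : ∀ S, MeasurableSet S → Memℓp (fun i => ∫ z in S, b' i z ∂m) 2)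
    (h : ∀ S S', MeasurableSet S → MeasurableSet S' →
      ∑' i, (∫ z in S, a i z ∂m) * (∫ z in S', b i z ∂m) =
        ∑' i, (∫ z in S, a' i z ∂m) * (∫ z in S', b' i z ∂m)) :
    ∃ P Q : Set Z, (∀ᵐ z ∂m, z ∈ P) ∧ (∀ᵐ z ∂m, z ∈ Q) ∧ ∀ x ∈ P, ∀ y ∈ Q,
      ∑' i, a i x * b i y = ∑' i, a' i x * b' i y := by
  have hsep := separableSpace_ellTwo
  -- almost every `x` has the property for almost every `y`
  obtain ⟨D, hD, hDcl⟩ := exists_countable_dense_subfamily (E := lp (fun _ : ℕ => ℂ) 2 ×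
    lp (fun _ : ℕ => ℂ) 2) (fun S : {S : Set Z // MeasurableSet S} =>
      (⟨_, hβ S.1 S.2⟩, ⟨_, hβ' S.1 S.2⟩))
  have h1 : ∀ᵐ x ∂m, ∀ᵐ y ∂m, ∑' i, a i x * b i y = ∑' i, a' i x * b' i y := by
    filter_upwards [haC, haC', (ae_ball_iff hD).2 fun S _ => ae_tsum_mul_eq ha ha' haC haC'
      (hβ S.1 S.2) (hβ' S.1 S.2) fun S' hS' => h S' S.1 hS' S.2] with x hx hx' hxD
    have hm := memℓp_two_of_sum_le hx
    have hm' := memℓp_two_of_sum_le hx'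
    have hall : ∀ S (hS : MeasurableSet S), ∑' i, a i x * ∫ z in S, b i z ∂m =
        ∑' i, a' i x * ∫ z in S, b' i z ∂m := by
      intro S hS
      have hclosed : IsClosed {q : lp (fun _ : ℕ => ℂ) 2 × lp (fun _ : ℕ => ℂ) 2 |
          ellTwoPairing ⟨_, hm⟩ q.1 = ellTwoPairing ⟨_, hm'⟩ q.2} :=
        isClosed_eq ((continuous_ellTwoPairing_right _).comp continuous_fst)
          ((continuous_ellTwoPairing_right _).comp continuous_snd)
      have := closure_minimal (Set.image_subset_iff.2 fun S hS => ?_) hclosed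
        (hDcl ⟨⟨S, hS⟩, rfl⟩)
      · simpa only [Set.mem_ofPred_eq, ellTwoPairing_eq_tsum] using this
      · simpa only [Set.mem_preimage, Set.mem_ofPred_eq, ellTwoPairing_eq_tsum] using hxD S hS
    have := ae_tsum_mul_eq hb hb' hbC hbC' hm hm' fun S hS => by
      simpa only [mul_comm] using hall S hS
    simpa only [mul_comm] using this
  set P : Set Z := {x | (∀ᵐ y ∂m, ∑' i, a i x * b i y = ∑' i, a' i x * b' i y) ∧
    (∀ s : Finset ℕ, ∑ i ∈ s, ‖a i x‖ ^ 2 ≤ C) ∧ ∀ s : Finset ℕ, ∑ i ∈ s, ‖a' i x‖ ^ 2 ≤ C}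
  -- The same device with the vectors `(aᵢ(x))` replaces the null set depending on `x` by a single
  -- one, which yields a product set.
  obtain ⟨D', hD', hD'cl⟩ := exists_countable_dense_subfamily (E := lp (fun _ : ℕ => ℂ) 2 ×
    lp (fun _ : ℕ => ℂ) 2) (fun x : P => (⟨fun i => a i x.1, memℓp_two_of_sum_le x.2.2.1⟩,
      ⟨fun i => a' i x.1, memℓp_two_of_sum_le x.2.2.2⟩))
  refine ⟨P, {y | (∀ x ∈ D', ∑' i, a i x.1 * b i y = ∑' i, a' i x.1 * b' i y) ∧
    (∀ s : Finset ℕ, ∑ i ∈ s, ‖b i y‖ ^ 2 ≤ C) ∧ ∀ s : Finset ℕ, ∑ i ∈ s, ‖b' i y‖ ^ 2 ≤ C},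
    ?_, ?_, ?_⟩
  · filter_upwards [h1, haC, haC'] with x h2 h3 h4 using ⟨h2, h3, h4⟩
  · filter_upwards [(ae_ball_iff hD').2 fun x _ => x.2.1, hbC, hbC'] with y h2 h3 h4
      using ⟨h2, h3, h4⟩
  · rintro x hx y ⟨hy1, hy2, hy3⟩
    have hm := memℓp_two_of_sum_le hy2
    have hm' := memℓp_two_of_sum_le hy3
    have hclosed : IsClosed {q : lp (fun _ : ℕ => ℂ) 2 × lp (fun _ : ℕ => ℂ) 2 |
        ellTwoPairing q.1 ⟨_, hm⟩ = ellTwoPairing q.2 ⟨_, hm'⟩} :=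
      isClosed_eq ((continuous_ellTwoPairing_left _).comp continuous_fst)
        ((continuous_ellTwoPairing_left _).comp continuous_snd)
    have := closure_minimal (Set.image_subset_iff.2 fun x hx => ?_) hclosed
      (hD'cl ⟨⟨x, hx⟩, rfl⟩)
    · simpa only [Set.mem_ofPred_eq, ellTwoPairing_eq_tsum] using this
    · simpa only [Set.mem_preimage, Set.mem_ofPred_eq, ellTwoPairing_eq_tsum] using hy1 x hx

end SquareSummable

namespace FeldmanMoore

variable {X : Type*} [MeasurableSpace X] [StandardBorelSpace X] {F : FeldmanMoore X}

/-! ### Diagonal operators and the symbols of series -/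

/-- The part of the diagonal over `S`. -/
def diagonalPart (S : Set X) : Set (X × X) := Prod.snd ⁻¹' S ∩ graph id

lemma measurableSet_diagonalPart {S : Set X} (hS : MeasurableSet S) :
    MeasurableSet (diagonalPart S) :=
  (measurable_snd hS).inter (measurableSet_graph measurable_id)

lemma lintegral_diagonalPart {S : Set X} (hS : MeasurableSet S) {h : X × X → ℝ≥0∞}
    (hh : Measurable h) : ∫⁻ p in diagonalPart S, h p ∂F.ν = ∫⁻ z in S, h (z, z) ∂F.μ := by
  have hm : Measurable fun z : X => (id z, z) := measurable_id.prodMk measurable_id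
  rw [diagonalPart, ← Measure.restrict_restrict (measurable_snd hS),
    F.restrict_graph measurable_id F.rel_refl, Measure.restrict_map hm (measurable_snd hS),
    lintegral_map hh hm]
  rfl

lemma integral_diagonalPart {S : Set X} (hS : MeasurableSet S) {h : X × X → ℂ}
    (hh : Measurable h) : ∫ p in diagonalPart S, h p ∂F.ν = ∫ z in S, h (z, z) ∂F.μ := by
  have hm : Measurable fun z : X => (id z, z) := measurable_id.prodMk measurable_id
  rw [diagonalPart, ← Measure.restrict_restrict (measurable_snd hS),
    F.restrict_graph measurable_id F.rel_refl, Measure.restrict_map hm (measurable_snd hS),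
    integral_map hm.aemeasurable hh.aestronglyMeasurable]
  rfl

lemma ν_diagonalPart_ne_top (S : Set X) : F.ν (diagonalPart S) ≠ ∞ :=
  ne_top_of_le_ne_top F.ν_diagonal_ne_top (measure_mono fun _ hp => hp.2)

variable (F) in
/-- The indicator function of the part of the diagonal over `S`. -/
noncomputable def diagonalVector (S : Set X) (hS : MeasurableSet S) : F.Hil :=
  indicatorConstLp 2 (measurableSet_diagonalPart hS) (ν_diagonalPart_ne_top S) (1 : ℂ)

variable {α : X → ℂ} {T : F.Hil →L[ℂ] F.Hil}

lemma apply_diagonalVector (hT : IsMultiplication (fun p : X × X => α p.1) T)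
    {S : Set X} (hS : MeasurableSet S) :
    T (F.diagonalVector S hS) =ᵐ[F.ν] (diagonalPart S).indicator fun p => α p.1 := by
  filter_upwards [hT (F.diagonalVector S hS), indicatorConstLp_coeFn (p := 2)
    (hs := measurableSet_diagonalPart hS) (hμs := F.ν_diagonalPart_ne_top S)
    (c := (1 : ℂ))] with p h1 h2
  rw [h1, show F.diagonalVector S hS p = _ from h2]
  by_cases hp : p ∈ diagonalPart S <;> simp [hp]

lemma enorm_sq_apply_diagonalVector (hα : Measurable α)
    (hT : IsMultiplication (fun p : X × X => α p.1) T) {S : Set X} (hS : MeasurableSet S) :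
    ‖T (F.diagonalVector S hS)‖ₑ ^ 2 = ∫⁻ z in S, ‖α z‖ₑ ^ 2 ∂F.μ := by
  rw [Lp.enorm_def, eLpNorm_congr_ae (apply_diagonalVector hT hS), eLpNorm_two_eq]
  rw [← ENNReal.rpow_natCast, ← ENNReal.rpow_mul]
  norm_num
  rw [← lintegral_diagonalPart (F := F) (h := fun p => ‖α p.1‖ₑ ^ 2) hS
    ((hα.comp measurable_fst).enorm.pow_const 2),
    ← lintegral_indicator (measurableSet_diagonalPart hS)]
  refine lintegral_congr fun p => ?_
  by_cases hp : p ∈ diagonalPart S <;> simp [hp]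

lemma enorm_sq_diagonalVector {S : Set X} (hS : MeasurableSet S) :
    ‖F.diagonalVector S hS‖ₑ ^ 2 = F.μ S := by
  have : IsMultiplication (m := F.ν) (fun p : X × X => (fun _ : X => (1 : ℂ)) p.1)
      (ContinuousLinearMap.id ℂ _) := fun ξ => ae_of_all _ fun p => by simp
  simpa using enorm_sq_apply_diagonalVector (α := fun _ => 1) measurable_const this hS

/-- Integrals over sets become vector functionals, the data that equality in the tensor product
controls. -/
lemma inner_apply_diagonalVector (hα : Measurable α)
    (hT : IsMultiplication (fun p : X × X => α p.1) T) {S : Set X} (hS : MeasurableSet S) :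
    inner ℂ (F.diagonalVector Set.univ MeasurableSet.univ) (T (F.diagonalVector S hS)) =
      ∫ z in S, α z ∂F.μ := by
  rw [diagonalVector, L2.inner_indicatorConstLp_one,
    setIntegral_congr_ae (measurableSet_diagonalPart MeasurableSet.univ)
      ((apply_diagonalVector hT hS).mono fun p hp _ => hp),
    setIntegral_indicator (measurableSet_diagonalPart hS)]
  have : diagonalPart Set.univ ∩ diagonalPart S = diagonalPart S :=
    Set.inter_eq_right.2 fun p hp => ⟨Set.mem_univ _, hp.2⟩
  rw [this, integral_diagonalPart (h := fun p => α p.1) hS (hα.comp measurable_fst)]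

/-- A column of multiplication operators is bounded pointwise. -/
lemma ae_sum_sq_le {a : ℕ → X → ℂ} {S : ℕ → (F.Hil →L[ℂ] F.Hil)} {C : ℝ} (hC : 0 ≤ C)
    (ha : ∀ i, Measurable (a i)) (hS : ∀ i, IsMultiplication (fun p : X × X => a i p.1) (S i))
    (hbd : IsColumnBounded S C) :
    ∀ᵐ z ∂F.μ, ∀ s : Finset ℕ, ∑ i ∈ s, ‖a i z‖ ^ 2 ≤ C := by
  have := F.isProbabilityMeasure
  refine ae_all_iff.2 fun s => ?_
  -- The column bound tested on the diagonal vector of `E` is the integrated form of the pointwise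
  -- bound.
  have key : ∀ E, MeasurableSet E → F.μ E < ∞ →
      ∫⁻ z in E, ∑ i ∈ s, ‖a i z‖ₑ ^ 2 ∂F.μ ≤ ∫⁻ _ in E, ENNReal.ofReal C ∂F.μ := by
    intro E hE _
    rw [lintegral_finsetSum _ fun i _ => (ha i).enorm.pow_const 2, setLIntegral_const,
      ← enorm_sq_diagonalVector hE]
    have h1 := ENNReal.ofReal_le_ofReal (hbd (F.diagonalVector E hE) s)
    rw [ENNReal.ofReal_sum_of_nonneg fun _ _ => sq_nonneg _, ENNReal.ofReal_mul hC] at h1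
    simp only [ENNReal.ofReal_pow (norm_nonneg _), ofReal_norm] at h1
    refine le_trans (le_of_eq (Finset.sum_congr rfl fun i _ => ?_)) h1
    exact (enorm_sq_apply_diagonalVector (ha i) (hS i) hE).symm
  have hle := ae_le_of_forall_setLIntegral_le_of_sigmaFinite
    (Finset.measurable_fun_sum s fun i _ => (ha i).enorm.pow_const 2) key
  filter_upwards [hle] with z hz
  rw [← ENNReal.ofReal_le_ofReal_iff hC, ENNReal.ofReal_sum_of_nonneg fun _ _ => sq_nonneg _]
  simpa only [ENNReal.ofReal_pow (norm_nonneg _), ofReal_norm] using hz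

/-! ### The function of a series and the Schur multiplier it defines. -/

section Series

variable (w : EhSeries F.cartanMasa)

/-- A bound for the rows and columns of a series. -/
noncomputable def _root_.EhSeries.bound {H : Type*} [NormedAddCommGroup H] [InnerProductSpace ℂ H]
    [CompleteSpace H] {𝒜 : Set (H →L[ℂ] H)} (w : EhSeries 𝒜) : ℝ := max ‖w.row‖ ‖w.col‖

lemma _root_.EhSeries.bound_nonneg {H : Type*} [NormedAddCommGroup H] [InnerProductSpace ℂ H]
    [CompleteSpace H] {𝒜 : Set (H →L[ℂ] H)} (w : EhSeries 𝒜) : 0 ≤ w.bound :=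
  le_max_of_le_left (norm_nonneg _)

variable {w} {a b : ℕ → X → ℂ}

lemma ae_sum_sq_le_left (ha : ∀ i, F.IsDiagonal (a i) (w.A i)) :
    ∀ᵐ z ∂F.μ, ∀ s : Finset ℕ, ∑ i ∈ s, ‖a i z‖ ^ 2 ≤ w.bound := by
  have := ae_sum_sq_le (a := fun i z => star (a i z)) w.bound_nonneg
    (fun i => continuous_star.measurable.comp (ha i).1)
    (fun i => by
      obtain ⟨C, hC⟩ := (ha i).2.1
      exact (ha i).isMultiplication.conj ((ha i).1.comp measurable_fst) fun p => hC p.1)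
    (w.isColumnBounded_A.mono (le_max_left _ _))
  simpa only [norm_star] using this

lemma ae_sum_sq_le_right (hb : ∀ i, F.IsDiagonal (b i) (w.B i)) :
    ∀ᵐ z ∂F.μ, ∀ s : Finset ℕ, ∑ i ∈ s, ‖b i z‖ ^ 2 ≤ w.bound :=
  ae_sum_sq_le w.bound_nonneg (fun i => (hb i).1) (fun i => (hb i).isMultiplication)
    (w.isColumnBounded_B.mono (le_max_right _ _))

lemma ae_sum_norm_mul_le (ha : ∀ i, F.IsDiagonal (a i) (w.A i))
    (hb : ∀ i, F.IsDiagonal (b i) (w.B i)) :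
    ∀ᵐ p ∂F.ν, ∀ s : Finset ℕ, ∑ i ∈ s, ‖a i p.1 * b i p.2‖ ≤ w.bound := by
  filter_upwards [F.ae_ν_fst (ae_sum_sq_le_left ha), F.ae_ν_snd (ae_sum_sq_le_right hb)]
    with p h1 h2 s
  exact (sum_norm_mul_le_of_sq_le h1 h2 s).trans (le_of_eq (Real.mul_self_sqrt w.bound_nonneg))

lemma memLp_tsum (ha : ∀ i, F.IsDiagonal (a i) (w.A i)) (hb : ∀ i, F.IsDiagonal (b i) (w.B i)) :
    MemLp (fun p : X × X => ∑' i, a i p.1 * b i p.2) ∞ F.ν := by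
  have hs : ∀ᵐ p ∂F.ν, Summable fun i => ‖a i p.1 * b i p.2‖ :=
    (ae_sum_norm_mul_le ha hb).mono fun p hp => summable_of_sum_le (fun _ => norm_nonneg _) hp
  refine memLp_top_of_bound (aestronglyMeasurable_tsum (fun i =>
    (((ha i).1.comp measurable_fst).mul ((hb i).1.comp measurable_snd)).aestronglyMeasurable)
    (hs.mono fun p hp => hp.of_norm)) w.bound ?_
  filter_upwards [ae_sum_norm_mul_le ha hb, hs] with p h1 h2
  exact (norm_tsum_le_tsum_norm h2).trans (h2.tsum_le_of_sum_le h1)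

lemma apply_χΔ_eq {β : X → ℂ} {S R : F.Hil →L[ℂ] F.Hil}
    (hS : IsMultiplication (fun p : X × X => β p.1) S)
    (hR : IsMultiplication (fun p : X × X => β p.2) R) : S F.χΔ = R F.χΔ := by
  refine Lp.ext ?_
  filter_upwards [hS F.χΔ, hR F.χΔ, F.χΔ_ae] with p h1 h2 h3
  rw [h1, h2]
  by_cases hp : p.1 = p.2
  · rw [hp]
  · rw [h3.2 hp, mul_zero, mul_zero]

/-- The symbol of `∑ᵢ Aᵢ T Bᵢ` is the product of the function of the series and the symbol
of `T`. -/
lemma symbol_map_eq (ha : ∀ i, F.IsDiagonal (a i) (w.A i)) (hb : ∀ i, F.IsDiagonal (b i) (w.B i))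
    {φ : Lp ℂ ∞ F.ν} (hφ : ∀ᵐ p ∂F.ν, φ p = ∑' i, a i p.1 * b i p.2)
    {T : F.Hil →L[ℂ] F.Hil} (hT : T ∈ F.M) :
    F.symbol (w.map T) = (φ • F.symbol T : Lp ℂ 2 F.ν) := by
  rw [← multiplication_apply]
  refine ext_inner_left ℂ fun η => ?_
  refine (w.hasSum_inner_map T F.χΔ η).unique ?_
  have hint : Integrable (fun p => inner ℂ (η p) (F.symbol T p)) F.ν :=
    L2.integrable_inner (𝕜 := ℂ) η (F.symbol T)
  have hterm : ∀ i, inner ℂ η ((w.A i * T * w.B i) F.χΔ) =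
      ∫ p, a i p.1 * b i p.2 * inner ℂ (η p) (F.symbol T p) ∂F.ν := by
    intro i
    obtain ⟨hbm, ⟨C, hC⟩, -⟩ := hb i
    obtain ⟨R, hR⟩ := exists_isMultiplication (m := F.ν) (hbm.comp measurable_snd)
      fun p => hC p.2
    have hcomm : T * R = R * T := mul_eq_mul_of_isMultiplication hbm hC hR hT
    -- On χ_Δ left and right multiplication by `bᵢ` agree, and the right one passes through `T`.
    have h1 : (w.A i * T * w.B i) F.χΔ = w.A i (R (F.symbol T)) := by
      change w.A i (T (w.B i F.χΔ)) = _
      rw [apply_χΔ_eq (hb i).isMultiplication hR]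
      change w.A i ((T * R) F.χΔ) = _
      rw [hcomm]
      rfl
    rw [h1, L2.inner_def]
    refine integral_congr_ae ?_
    filter_upwards [(ha i).isMultiplication (R (F.symbol T)), hR (F.symbol T)] with p h2 h3
    rw [h2, h3]
    simp only [RCLike.inner_apply, Function.comp]
    ring
  have hlim : inner ℂ η (multiplication φ (F.symbol T)) =
      ∫ p, ∑' i, a i p.1 * b i p.2 * inner ℂ (η p) (F.symbol T p) ∂F.ν := by
    rw [L2.inner_def]
    refine integral_congr_ae ?_
    filter_upwards [isMultiplication_multiplication φ (F.symbol T), hφ] with p h2 h3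
    rw [h2, h3, tsum_mul_right]
    simp only [RCLike.inner_apply]
    ring
  simp_rw [hterm]
  rw [hlim]
  refine hasSum_integral_tsum (g := fun p => w.bound * ‖inner ℂ (η p) (F.symbol T p)‖)
    (fun i => ?_) (hint.norm.const_mul _) ?_
  · exact ((((ha i).1.comp measurable_fst).mul
      ((hb i).1.comp measurable_snd)).aestronglyMeasurable).mul hint.aestronglyMeasurable
  · filter_upwards [ae_sum_norm_mul_le ha hb] with p hp s
    simp only [norm_mul _ (inner ℂ (η p) (F.symbol T p))]
    rw [← Finset.sum_mul]
    exact mul_le_mul_of_nonneg_right (hp s) (norm_nonneg _)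

/-- Every term lies in `M`; commuting with a fixed operator can be checked on matrix coefficients,
so it survives the sum. -/
lemma map_mem_M (w : EhSeries F.cartanMasa) {T : F.Hil →L[ℂ] F.Hil} (hT : T ∈ F.M) :
    w.map T ∈ F.M := by
  have hA : ∀ i, w.A i ∈ F.M := fun i => by
    obtain ⟨α, hα⟩ := w.A_mem i
    exact mem_M_of_mem_M₀ hα.mem_M₀
  have hB : ∀ i, w.B i ∈ F.M := fun i => by
    obtain ⟨α, hα⟩ := w.B_mem i
    exact mem_M_of_mem_M₀ hα.mem_M₀
  have hterm : ∀ i, w.A i * T * w.B i ∈ StarSubalgebra.centralizer ℂ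
      (StarSubalgebra.centralizer ℂ F.M₀ : Set (F.Hil →L[ℂ] F.Hil)) := fun i =>
    mul_mem (mul_mem (hA i) hT) (hB i)
  have key : ∀ g ∈ StarSubalgebra.centralizer ℂ F.M₀, g * w.map T = w.map T * g := by
    intro g hg
    refine ContinuousLinearMap.ext fun ξ => ext_inner_left ℂ fun η => ?_
    have h1 := w.hasSum_inner_map T ξ (star g η)
    have h2 := w.hasSum_inner_map T (g ξ) η
    have h3 : inner ℂ (star g η) (w.map T ξ) = inner ℂ η ((g * w.map T) ξ) := by
      rw [ContinuousLinearMap.star_eq_adjoint, ContinuousLinearMap.adjoint_inner_left]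
      rfl
    rw [← h3]
    have h4 : ∀ i, inner ℂ (star g η) ((w.A i * T * w.B i) ξ) =
        inner ℂ η ((w.A i * T * w.B i) (g ξ)) := fun i => by
      rw [ContinuousLinearMap.star_eq_adjoint, ContinuousLinearMap.adjoint_inner_left]
      have := ((StarSubalgebra.mem_centralizer_iff ℂ).1 (hterm i) g hg).1
      exact congrArg (inner ℂ η) (DFunLike.congr_fun this ξ)
    simp_rw [h4] at h1
    exact h1.unique h2
  change w.map T ∈ StarSubalgebra.centralizer ℂ
      (StarSubalgebra.centralizer ℂ F.M₀ : Set (F.Hil →L[ℂ] F.Hil))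
  rw [StarSubalgebra.mem_centralizer_iff]
  exact fun g hg => ⟨key g hg, key _ (star_mem hg)⟩

/-- The integrals are inner products of `Bᵢ χ_S` with one fixed vector, so the column bound makes
them square summable. -/
lemma memℓp_setIntegral (hb : ∀ i, F.IsDiagonal (b i) (w.B i)) (S : Set X)
    (hS : MeasurableSet S) : Memℓp (fun i => ∫ z in S, b i z ∂F.μ) 2 := by
  set χ := F.diagonalVector Set.univ MeasurableSet.univ
  refine memℓp_two_of_sum_le
    (C := ‖χ‖ ^ 2 * (‖w.col‖ * ‖F.diagonalVector S hS‖ ^ 2)) fun s => ?_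
  refine le_trans ?_ (mul_le_mul_of_nonneg_left
    (w.isColumnBounded_B (F.diagonalVector S hS) s) (sq_nonneg _))
  rw [Finset.mul_sum]
  refine Finset.sum_le_sum fun i _ => ?_
  rw [← inner_apply_diagonalVector (hb i).1 (hb i).isMultiplication hS, ← mul_pow]
  exact pow_le_pow_left₀ (norm_nonneg _) (norm_inner_le_norm _ _) 2

/-- The function of a series depends only on the element that it represents. -/
lemma ae_tsum_eq_of_represents {u : EhTensor F.cartanMasa} {v : EhSeries F.cartanMasa}
    {a' b' : ℕ → X → ℂ} (hw : EhTensor.Represents w u) (hv : EhTensor.Represents v u)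
    (ha : ∀ i, F.IsDiagonal (a i) (w.A i)) (hb : ∀ i, F.IsDiagonal (b i) (w.B i))
    (ha' : ∀ i, F.IsDiagonal (a' i) (v.A i)) (hb' : ∀ i, F.IsDiagonal (b' i) (v.B i)) :
    ∀ᵐ p ∂F.ν, ∑' i, a i p.1 * b i p.2 = ∑' i, a' i p.1 * b' i p.2 := by
  have := F.isProbabilityMeasure
  have hbd : ∀ {f : ℕ → X → ℂ} {B C : ℝ}, B ≤ C →
      (∀ᵐ z ∂F.μ, ∀ s : Finset ℕ, ∑ i ∈ s, ‖f i z‖ ^ 2 ≤ B) →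
      ∀ᵐ z ∂F.μ, ∀ s : Finset ℕ, ∑ i ∈ s, ‖f i z‖ ^ 2 ≤ C := fun hBC h =>
    h.mono fun z hz s => (hz s).trans hBC
  obtain ⟨P, Q, hP, hQ, h⟩ := exists_forall_tsum_mul_eq (m := F.μ)
    (fun i => (ha i).1) (fun i => (ha' i).1) (fun i => (hb i).1) (fun i => (hb' i).1)
    (hbd (le_max_left w.bound v.bound) (ae_sum_sq_le_left ha))
    (hbd (le_max_right w.bound v.bound) (ae_sum_sq_le_left ha'))
    (hbd (le_max_left w.bound v.bound) (ae_sum_sq_le_right hb))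
    (hbd (le_max_right w.bound v.bound) (ae_sum_sq_le_right hb'))
    (memℓp_setIntegral hb) (memℓp_setIntegral hb') fun S S' hS hS' => by
      simpa only [inner_apply_diagonalVector (ha _).1 (ha _).isMultiplication,
        inner_apply_diagonalVector (hb _).1 (hb _).isMultiplication,
        inner_apply_diagonalVector (ha' _).1 (ha' _).isMultiplication,
        inner_apply_diagonalVector (hb' _).1 (hb' _).isMultiplication] using
        tsum_inner_mul_inner_eq hw hv (F.diagonalVector S hS)
          (F.diagonalVector Set.univ MeasurableSet.univ) (F.diagonalVector S' hS')
          (F.diagonalVector Set.univ MeasurableSet.univ)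
  filter_upwards [F.ae_ν_fst hP, F.ae_ν_snd hQ] with p h1 h2
  exact h p.1 h1 p.2 h2

end Series

/-- Every element of the extended Haagerup tensor product has a symbol. -/
lemma exists_isEhSymbol (u : EhTensor F.cartanMasa) : ∃ φ, F.IsEhSymbol u φ := by
  obtain ⟨w, hw⟩ := u.exists_represents
  choose a ha using w.A_mem
  choose b hb using w.B_mem
  refine ⟨(memLp_tsum ha hb).toLp, fun v hv a' b' ha' hb' => ?_⟩
  filter_upwards [(memLp_tsum ha hb).coeFn_toLp, ae_tsum_eq_of_represents hw hv ha hb ha' hb']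
    with p h1 h2
  rw [h1, h2]

lemma IsEhSymbol.symbol_map {u : EhTensor F.cartanMasa} {φ : Lp ℂ ∞ F.ν} (hφ : F.IsEhSymbol u φ)
    {w : EhSeries F.cartanMasa} (hw : EhTensor.Represents w u) {T : F.Hil →L[ℂ] F.Hil}
    (hT : T ∈ F.M) : F.symbol (w.map T) = (φ • F.symbol T : Lp ℂ 2 F.ν) := by
  choose a ha using w.A_mem
  choose b hb using w.B_mem
  exact symbol_map_eq ha hb (hφ w hw a b ha hb) hT

lemma IsEhSymbol.mem_schurMultipliers {u : EhTensor F.cartanMasa} {φ : Lp ℂ ∞ F.ν}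
    (hφ : F.IsEhSymbol u φ) : φ ∈ F.schurMultipliers := by
  obtain ⟨w, hw⟩ := u.exists_represents
  rintro _ ⟨T, hT, rfl⟩
  exact ⟨w.map T, map_mem_M w hT, hφ.symbol_map hw hT⟩

lemma IsEhSymbol.schurMap_eq {u : EhTensor F.cartanMasa} {φ : Lp ℂ ∞ F.ν}
    (hφ : F.IsEhSymbol u φ) {w : EhSeries F.cartanMasa} (hw : EhTensor.Represents w u)
    {T : F.Hil →L[ℂ] F.Hil} (hT : T ∈ F.M) : F.schurMap φ T = w.map T := by
  rw [schurMap, ← hφ.symbol_map hw hT, invSymbol_symbol (map_mem_M w hT)]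

end FeldmanMoore

theorem theorem5p5 {X : Type*} [MeasurableSpace X] [StandardBorelSpace X] (F : FeldmanMoore X) :
    (∀ u : EhTensor F.cartanMasa,
      ∃ (φ : Lp ℂ ∞ F.ν) (Ψ : (F.Hil →L[ℂ] F.Hil) →ₗ[ℂ] (F.Hil →L[ℂ] F.Hil)),
        F.IsEhSymbol u φ ∧ u.IsInducedMap Ψ ∧ IsCompletelyBounded Ψ ∧
        φ ∈ F.schurMultipliers ∧
        ∃ m : F.M.toStarSubalgebra →L[ℂ] F.M.toStarSubalgebra,
          (∀ T : F.M.toStarSubalgebra, (m T : F.Hil →L[ℂ] F.Hil) = F.schurMap φ T) ∧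
          (∀ T : F.M.toStarSubalgebra, F.schurMap φ T = Ψ T) ∧
          ‖m‖ ≤ u.ehNorm) ∧
    F.ehMultipliers ⊆ F.schurMultipliers := by
  refine ⟨fun u => ?_, fun φ ⟨u, hu⟩ => hu.mem_schurMultipliers⟩
  -- One series suffices: its map and symbol are those of every representative.
  obtain ⟨w, hw⟩ := u.exists_represents
  obtain ⟨φ, hφ⟩ := FeldmanMoore.exists_isEhSymbol u
  refine ⟨φ, w.map, hφ, EhSeries.isInducedMap_map hw, w.isCompletelyBounded_map,
    hφ.mem_schurMultipliers, LinearMap.mkContinuous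
      { toFun := fun T => ⟨w.map T, FeldmanMoore.map_mem_M w T.2⟩
        map_add' := fun T T' => Subtype.ext (map_add w.map _ _)
        map_smul' := fun c T => Subtype.ext (map_smul w.map c _) }
      u.ehNorm fun T => EhTensor.norm_map_le hw T.1,
    fun T => (hφ.schurMap_eq hw T.2).symm, fun T => hφ.schurMap_eq hw T.2,
    LinearMap.mkContinuous_norm_le _ u.ehNorm_nonneg _⟩
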